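/- Let $\ell\ge 0$, $n=\ell+1$, $\mu_2=\{\pm1\}\subset\mathbb{R}^*$, and let $H_{\mathbb{H}}=(\mathbb{H}^*)^{n}\subset GL_{n}(\mathbb{H})$ be the subgroup of diagonal matrices over the quaternions. The quaternionic Weyl group $W_{GL_n}(\mathbb{H})\subset\mathrm{Aut}(H_{\mathbb{H}})$ is the group of automorphisms of $H_{\mathbb{H}}$ induced by conjugation by elements of $GL_n(\mathbb{H})$ normalizing $H_{\mathbb{H}}$. Identify $SU_2$ with the group of unit quaternions via the standard representation $\mathbb{H}\to \mathrm{Mat}_2(\mathbb{C})$, let $\pi:SU_2\to SO_3(\mathbb{R})$ send $q$ to the rotation $x\mapsto qxq^{-1}$ of the imaginary quaternions, and let $SO_3(\mathbb{R})$ act on $\mathbb{H}$ by rotating imaginary parts and fixing real parts. In the semidirect products below $\mathfrak{S}_n$ permutes the $n$ factors. 1. The sequence $1\to\mu_2\to SU_2\xrightarrow{\pi}SO_3(\mathbb{R})\to1$ is exact. There is an isomorphism $\Theta:\mathfrak{S}_n\ltimes SO_3(\mathbb{R})^n\to W_{GL_n}(\mathbb{H})$, where $(R,\sigma)$ acts on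 $H_{\mathbb{H}}$ by $(d_i)\mapsto (R_i\, d_{\sigma^{-1}(i)})$. Put $\widetilde W_{GL_n}(\mathbb{H})=\mathfrak{S}_n\ltimes (SU_2)^n$. The map $p=\Theta\circ(\mathrm{id}\ltimes\pi^n)$ and the inclusion $(\mu_2)^n\subset (SU_2)^n$ give an exact sequence $$1\to(\mu_2)^{n}\to\widetilde W_{GL_n}(\mathbb{H})\xrightarrow{p}W_{GL_n}(\mathbb{H})\to1 .\qquad (*)$$ 2. The map $(q,\sigma)\mapsto \mathrm{diag}(q_1,\dots,q_n)P_\sigma$, with $P_\sigma$ the permutation matrix of $\sigma$, is an injective homomorphism $\widetilde W_{GL_n}(\mathbb{H})\to GL_n(\mathbb{H})$. Its image normalizes $H_{\mathbb{H}}$, and the image of $x$ acts on $H_{\mathbb{H}}$ by conjugation as $p(x)$. 3. Let $Sp_{2n}(\mathbb{C})=\{g\in GL_{2n}(\mathbb{C}): g=S(g^{\tau})^{-1}S^{-1}\}$, with $S=\mathrm{diag}(1,-1,\dots,1,-1)$ and $\tau$ the reflection at the opposite diagonal. Let $H$ be its diagonal torus, consisting of the matrices $\mathrm{diag}(z_n,\dots,z_1,z_1^{-1},\dots,z_n^{-1})$,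 $z_i\in\mathbb{C}^*$, and let $N(H)$ be its normalizer in $Sp_{2n}(\mathbb{C})$. Put $W_{Sp_{2n}}=N(H)/H$. Let the Tits group $W^T_{Sp_{2n}}\subset N(H)$ be generated by $\dot s_k=\exp\bigl(\tfrac{\pi}{2}(f_k-e_k)\bigr)$, $1\le k\le n$, where $e_1=E_{n,n+1}$, $e_k=E_{n+1-k,n+2-k}+E_{n+k-1,n+k}$ for $1<k\le n$, $f_k=e_k^{t}$, and $E_{ab}$ are the matrix units; all the $\dot s_k$ do lie in $N(H)$. Then $W_{Sp_{2n}}\cong\mathfrak{S}_n\ltimes\mathrm{Gal}(\mathbb{C}/\mathbb{R})^n$, acting on $H$ by permuting the coordinates $z_i$ and, for each nontrivial Galois component, inverting the corresponding coordinate. Complex conjugation $\mapsto\pi(\jmath)$ defines a homomorphism $\gamma:\mathrm{Gal}(\mathbb{C}/\mathbb{R})\to SO_3(\mathbb{R})$ such that $\gamma(s)$, acting on $\mathbb{H}$, restricts to $s$ on $\mathbb{C}\subset\mathbb{H}$. Together with the isomorphism above and $\Theta$, this $\gamma$ induces an injective homomorphism $\mathrm{emb}:W_{Sp_{2n}}\to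 W_{GL_n}(\mathbb{H})$. 4. The projection $N(H)\to W_{Sp_{2n}}$ restricts to an exact sequence (the Tits extension) $$1\to(\mu_2)^{n}\to W^T_{Sp_{2n}}\to W_{Sp_{2n}}\to1,\qquad(**)$$ where $(\mu_2)^n$ is identified with the subgroup of all elements $h\in H$ with $h^2=1$ by putting $z_i=\pm1$. The extension $(**)$ is the restriction of $(*)$ to $W_{Sp_{2n}}$: there is an isomorphism $\Phi: W^T_{Sp_{2n}}\to p^{-1}(\mathrm{emb}(W_{Sp_{2n}}))$ which is the identity on $(\mu_2)^n$ and satisfies $p(\Phi(g))=\mathrm{emb}(\bar g)$, where $\bar g$ is the class of $g$ in $W_{Sp_{2n}}$. -/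

import Mathlib

open Matrix Quaternion

namespace QuatWeyl

noncomputable section

/-! ### Wreath products with the symmetric group -/

/-- `𝔖_n ⋉ K^n`, where `σ ∈ 𝔖_n` acts on `K^n` by `(σ • k) i = k (σ⁻¹ i)`. -/
abbrev Wr (n : ℕ) (K : Type*) [Group K] : Type _ :=
  (Fin n → K) ⋊[(mulAutArrow : Equiv.Perm (Fin n) →* MulAut (Fin n → K))] Equiv.Perm (Fin n)

/-- The homomorphism `K^n → L^n` induced by `f : K → L`. -/
def piMap (n : ℕ) {K L : Type*} [Group K] [Group L] (f : K →* L) : (Fin n → K) →* (Fin n → L) where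
  toFun k i := f (k i)
  map_one' := by ext i; simp
  map_mul' a b := by ext i; simp

/-- The homomorphism `𝔖_n ⋉ K^n → 𝔖_n ⋉ L^n` induced by `f : K → L`
(it is the identity on `𝔖_n`). -/
def Wr.map (n : ℕ) {K L : Type*} [Group K] [Group L] (f : K →* L) : Wr n K →* Wr n L :=
  SemidirectProduct.map (piMap n f) (MonoidHom.id _) (by intro σ; ext k i; rfl)

/-! ### The diagonal subgroup of `GL_n(A)` and the Weyl group of `GL_n(A)` -/

/-- The diagonal matrix `diag(d_1, …, d_n)` of units, as an element of `GL_n(A)`. -/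
def diagHom (n : ℕ) (A : Type*) [Ring A] : (Fin n → Aˣ) →* GL (Fin n) A where
  toFun d := ⟨diagonal fun i => (d i : A), diagonal fun i => ((d i)⁻¹ : Aˣ),
    by simp [diagonal_mul_diagonal], by simp [diagonal_mul_diagonal]⟩
  map_one' := by ext1; simp
  map_mul' a b := by ext1; simp [diagonal_mul_diagonal]

/-- The diagonal subgroup `H_A = (A^*)^n` of `GL_n(A)`. -/
def diagSubgroup (n : ℕ) (A : Type*) [Ring A] : Subgroup (GL (Fin n) A) :=
  (diagHom n A).range

/-- An element of `(A^*)^n`, regarded as an element of the diagonal subgroup. -/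
def toDiag (n : ℕ) (A : Type*) [Ring A] : (Fin n → Aˣ) →* diagSubgroup n A :=
  (diagHom n A).rangeRestrict

/-- The Weyl group of `GL_n(A)`: the group of those automorphisms of the diagonal subgroup `H_A`
that are induced by conjugation in `GL_n(A)`, i.e. the image of the normalizer of `H_A` in
`Aut(H_A)`. -/
def WeylGroup (n : ℕ) (A : Type*) [Ring A] : Subgroup (MulAut (diagSubgroup n A)) :=
  (diagSubgroup n A).normalizerMonoidHom.range

/-- The map from the normalizer of `H_A` onto the Weyl group, given by conjugation. -/
def toWeyl (n : ℕ) (A : Type*) [Ring A] :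
    Subgroup.normalizer (diagSubgroup n A : Set (GL (Fin n) A)) →* WeylGroup n A :=
  (diagSubgroup n A).normalizerMonoidHom.rangeRestrict

/-- The monomial matrix `diag(d) P_σ`, where `P_σ` is the permutation matrix sending the `j`-th
basis vector to the `σ j`-th one. -/
def monomialMatrix (n : ℕ) (A : Type*) [Ring A] (d : Fin n → A) (σ : Equiv.Perm (Fin n)) :
    Matrix (Fin n) (Fin n) A :=
  Matrix.of fun i j => if i = σ j then d i else 0

theorem monomialMatrix_one (n : ℕ) (A : Type*) [Ring A] :
    monomialMatrix n A (fun _ => 1) 1 = 1 := by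
  ext i j
  by_cases h : i = j
  · subst h; simp [monomialMatrix]
  · simp [monomialMatrix, h]

theorem monomialMatrix_mul (n : ℕ) (A : Type*) [Ring A] (d e : Fin n → A)
    (σ τ : Equiv.Perm (Fin n)) :
    monomialMatrix n A d σ * monomialMatrix n A e τ =
      monomialMatrix n A (fun i => d i * e (σ⁻¹ i)) (σ * τ) := by
  ext i j
  rw [Matrix.mul_apply, Finset.sum_eq_single (τ j)]
  · by_cases h : i = σ (τ j)
    · subst h; simp [monomialMatrix]
    · simp [monomialMatrix, h]
  · intro k _ hk
    simp [monomialMatrix, hk]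
  · simp

/-- `𝔖_n ⋉ (A^*)^n → GL_n(A)`, `(d, σ) ↦ diag(d) P_σ`. -/
def monomialHom (n : ℕ) (A : Type*) [Ring A] : Wr n Aˣ →* GL (Fin n) A :=
  MonoidHom.toHomUnits
    { toFun := fun x => monomialMatrix n A (fun i => (x.left i : A)) x.right
      map_one' := monomialMatrix_one n A
      map_mul' := fun x y => by
        rw [monomialMatrix_mul]
        rfl }

/-! ### Unit quaternions, `SU_2` and the covering `SU_2 → SO_3` -/

/-- The group of quaternions of norm one. -/
abbrev UnitQuat : Type := unitary ℍ[ℝ]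

/-- The group `SU_2`. -/
abbrev SU2 : Type := Matrix.specialUnitaryGroup (Fin 2) ℂ

/-- The group `SO_3(ℝ)`. -/
abbrev SO3 : Type := Matrix.specialOrthogonalGroup (Fin 3) ℝ

/-- The group `μ_2 = {±1}` of square roots of unity in `ℝ`. -/
abbrev Mu2 : Type := rootsOfUnity 2 ℝ

/-- The complex `2 × 2` matrix of a quaternion `q_0 + q_1 i + q_2 j + q_3 k`. -/
def quatMatrix (q : ℍ[ℝ]) : Matrix (Fin 2) (Fin 2) ℂ :=
  !![(⟨q.re, q.imI⟩ : ℂ), ⟨q.imJ, q.imK⟩; -⟨q.imJ, -q.imK⟩, ⟨q.re, -q.imI⟩]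

/-- The imaginary quaternion `x_1 i + x_2 j + x_3 k`. -/
def imQuat (x : Fin 3 → ℝ) : ℍ[ℝ] := ⟨0, x 0, x 1, x 2⟩

@[simp] theorem re_imQuat (x : Fin 3 → ℝ) : (imQuat x).re = 0 := rfl

@[simp] theorem imI_imQuat (x : Fin 3 → ℝ) : (imQuat x).imI = x 0 := rfl

@[simp] theorem imJ_imQuat (x : Fin 3 → ℝ) : (imQuat x).imJ = x 1 := rfl

@[simp] theorem imK_imQuat (x : Fin 3 → ℝ) : (imQuat x).imK = x 2 := rfl

/-- The coordinates of the imaginary part of a quaternion. -/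
def imCoord (q : ℍ[ℝ]) : Fin 3 → ℝ := ![q.imI, q.imJ, q.imK]

/-- A rotation of `ℝ^3` acting on quaternions: it fixes the real part and rotates the imaginary
part. This is the standard identification of `SO_3(ℝ)` with `Aut(ℍ)`. -/
def rotAct (R : SO3) (q : ℍ[ℝ]) : ℍ[ℝ] :=
  (q.re : ℍ[ℝ]) + imQuat ((R : Matrix (Fin 3) (Fin 3) ℝ) *ᵥ imCoord q)

/-- The matrix of `x ↦ q x q̄` on imaginary quaternions, in the basis `i, j, k`. -/
def adMatrix (q : ℍ[ℝ]) : Matrix (Fin 3) (Fin 3) ℝ :=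
  Matrix.of fun r s => imCoord (q * imQuat (Pi.single s 1) * star q) r

theorem adMatrix_eq (q : ℍ[ℝ]) : adMatrix q =
    !![q.re ^ 2 + q.imI ^ 2 - q.imJ ^ 2 - q.imK ^ 2, 2 * (q.imI * q.imJ - q.re * q.imK),
        2 * (q.imI * q.imK + q.re * q.imJ);
      2 * (q.imI * q.imJ + q.re * q.imK), q.re ^ 2 - q.imI ^ 2 + q.imJ ^ 2 - q.imK ^ 2,
        2 * (q.imJ * q.imK - q.re * q.imI);
      2 * (q.imI * q.imK - q.re * q.imJ), 2 * (q.imJ * q.imK + q.re * q.imI),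
        q.re ^ 2 - q.imI ^ 2 - q.imJ ^ 2 + q.imK ^ 2] := by
  ext r s
  fin_cases r <;> fin_cases s <;> simp [adMatrix, imCoord, Pi.single_apply] <;> ring

theorem adMatrix_mul (p q : ℍ[ℝ]) : adMatrix (p * q) = adMatrix p * adMatrix q := by
  simp only [adMatrix_eq]
  ext r s
  fin_cases r <;> fin_cases s <;> simp [Matrix.mul_apply, Fin.sum_univ_three] <;> ring

theorem adMatrix_one : adMatrix 1 = 1 := by
  rw [adMatrix_eq]
  ext r s
  fin_cases r <;> fin_cases s <;> simp

theorem adMatrix_star (q : ℍ[ℝ]) : adMatrix (star q) = (adMatrix q)ᵀ := by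
  simp only [adMatrix_eq]
  ext r s
  fin_cases r <;> fin_cases s <;> simp <;> ring

theorem adMatrix_det (q : ℍ[ℝ]) : (adMatrix q).det = (normSq q) ^ 3 := by
  rw [adMatrix_eq, Matrix.det_fin_three, normSq_def']
  simp
  ring

theorem adMatrix_mem (q : UnitQuat) :
    adMatrix (q : ℍ[ℝ]) ∈ Matrix.specialOrthogonalGroup (Fin 3) ℝ := by
  have h1 : star (q : ℍ[ℝ]) * q = 1 := Unitary.star_mul_self_of_mem q.2
  have h2 : (q : ℍ[ℝ]) * star (q : ℍ[ℝ]) = 1 := Unitary.mul_star_self_of_mem q.2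
  rw [Matrix.mem_specialOrthogonalGroup_iff, Matrix.mem_orthogonalGroup_iff]
  constructor
  · rw [← adMatrix_star,
      ← adMatrix_mul, h2, adMatrix_one]
  · have h3 : normSq (q : ℍ[ℝ]) = 1 := by
      have := congrArg (fun x : ℍ[ℝ] => x.re) h2
      rwa [self_mul_star] at this
    rw [adMatrix_det, h3, one_pow]

/-- The covering `π : SU_2 → SO_3(ℝ)`: a unit quaternion `q` goes to the rotation
`x ↦ q x q⁻¹` of the space of imaginary quaternions. -/
def spin : UnitQuat →* SO3 where
  toFun q := ⟨adMatrix q, adMatrix_mem q⟩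
  map_one' := Subtype.ext adMatrix_one
  map_mul' p q := Subtype.ext (adMatrix_mul p q)

/-- The inclusion of `μ_2 = {±1}` into the group of unit quaternions. -/
def signHom : Mu2 →* UnitQuat where
  toFun e := ⟨(((e : ℝˣ) : ℝ) : ℍ[ℝ]), by
    have h : (((e : ℝˣ) : ℝ)) * (((e : ℝˣ) : ℝ)) = 1 := by
      have := (mem_rootsOfUnity' 2 (e : ℝˣ)).1 e.2
      rwa [pow_two] at this
    have h' : (((e : ℝˣ) : ℝ) : ℍ[ℝ]) * (((e : ℝˣ) : ℝ) : ℍ[ℝ]) = 1 := by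
      rw [← coe_mul, h, coe_one]
    rw [Unitary.mem_iff, star_coe]
    exact ⟨h', h'⟩⟩
  map_one' := Subtype.ext (by simp)
  map_mul' a b := Subtype.ext (by simp)

/-- The quaternion unit `j`. -/
def quatJ : UnitQuat := ⟨imQuat ![0, 1, 0], by
  rw [Unitary.mem_iff]
  constructor <;> ext <;> simp⟩

/-! ### The extended quaternionic Weyl group -/

/-- The extended group: `𝔖_n ⋉ (SU_2)^n`, with `SU_2` the group of unit quaternions. -/
abbrev ExtWeyl (n : ℕ) : Type := Wr n UnitQuat

/-- The inclusion `(μ_2)^n → 𝔖_n ⋉ (SU_2)^n`. -/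
def extInl (n : ℕ) : (Fin n → Mu2) →* ExtWeyl n :=
  SemidirectProduct.inl.comp (piMap n signHom)

/-- The natural map `𝔖_n ⋉ (SU_2)^n → GL_n(ℍ)`, `(q, σ) ↦ diag(q) P_σ`. -/
def extEmbedding (n : ℕ) : ExtWeyl n →* GL (Fin n) ℍ[ℝ] :=
  (monomialHom n ℍ[ℝ]).comp (Wr.map n Unitary.toUnits)

/-! ### The symplectic group, its Weyl group and its Tits group -/

/-- Reflection of a matrix at the opposite diagonal. -/
def antiTranspose {m : ℕ} (X : Matrix (Fin m) (Fin m) ℂ) : Matrix (Fin m) (Fin m) ℂ :=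
  Matrix.of fun i j => X j.rev i.rev

theorem antiTranspose_one {m : ℕ} : antiTranspose (1 : Matrix (Fin m) (Fin m) ℂ) = 1 := by
  ext i j
  simp [antiTranspose, Matrix.one_apply, eq_comm]

theorem antiTranspose_mul {m : ℕ} (X Y : Matrix (Fin m) (Fin m) ℂ) :
    antiTranspose (X * Y) = antiTranspose Y * antiTranspose X := by
  ext i j
  simp only [antiTranspose, Matrix.mul_apply, Matrix.of_apply]
  rw [← Equiv.sum_comp Fin.revPerm]
  exact Finset.sum_congr rfl fun k _ => by simp [mul_comm]

/-- The involution `g ↦ (g^τ)⁻¹` of `GL_m(ℂ)`, with `τ` the reflection at the opposite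
diagonal. -/
def iotaHom (m : ℕ) : GL (Fin m) ℂ →* GL (Fin m) ℂ where
  toFun g := ⟨antiTranspose (g⁻¹ : GL (Fin m) ℂ), antiTranspose (g : Matrix (Fin m) (Fin m) ℂ),
    by rw [← antiTranspose_mul, Units.mul_inv, antiTranspose_one],
    by rw [← antiTranspose_mul, Units.inv_mul, antiTranspose_one]⟩
  map_one' := by ext1; simp [antiTranspose_one]
  map_mul' a b := by ext1; simp [_root_.mul_inv_rev, antiTranspose_mul]

/-- The matrix `diag(1, -1, 1, -1, …)`. -/
def altSign (m : ℕ) : GL (Fin m) ℂ := diagHom m ℂ fun a => (-1) ^ (a : ℕ)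

/-- The involution `θ_C : g ↦ S (g^τ)⁻¹ S⁻¹` of `GL_m(ℂ)`, `S = diag(1, -1, 1, -1, …)`. -/
def thetaC (m : ℕ) : GL (Fin m) ℂ →* GL (Fin m) ℂ :=
  (MulAut.conj (altSign m)).toMonoidHom.comp (iotaHom m)

/-- The symplectic group `Sp_{2n}(ℂ)`, as the subgroup of `GL_{2n}(ℂ)` fixed by `θ_C`;
equivalently, the stabilizer of a non-degenerate alternating form. -/
def Sp (n : ℕ) : Subgroup (GL (Fin (2 * n)) ℂ) :=
  (thetaC (2 * n)).eqLocus (MonoidHom.id _)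

/-- The maximal torus of `Sp_{2n}(ℂ)`: its diagonal matrices. -/
def spTorus (n : ℕ) : Subgroup (Sp n) := (diagSubgroup (2 * n) ℂ).subgroupOf (Sp n)

/-- The normalizer of the maximal torus in `Sp_{2n}(ℂ)`. -/
abbrev spNormalizer (n : ℕ) : Subgroup (Sp n) := Subgroup.normalizer (spTorus n : Set (Sp n))

/-- The Weyl group of `Sp_{2n}(ℂ)`: the normalizer of the maximal torus modulo the torus. -/
abbrev SpWeyl (n : ℕ) : Type := spNormalizer n ⧸ (spTorus n).subgroupOf (spNormalizer n)

/-- The Chevalley generators `e_0, …, e_{n-1}` of the Lie algebra of `Sp_{2n}(ℂ)`. With rows and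
columns numbered from `0` and `E a b` the matrix units,
`e_0 = E (n-1) n` belongs to the long simple root, and
`e_i = E (n-1-i) (n-i) + E (n+i-1) (n+i)`, `0 < i < n`, to the short ones. -/
def chevE (n : ℕ) (i : Fin n) : Matrix (Fin (2 * n)) (Fin (2 * n)) ℂ :=
  Matrix.of fun a b =>
    if (a : ℕ) + 1 = b ∧ ((a : ℕ) + 1 + i = n ∨ (a : ℕ) + 1 = n + i) then 1 else 0

/-- The Chevalley generators `f_i`, the transposes of the `e_i`. -/
def chevF (n : ℕ) (i : Fin n) : Matrix (Fin (2 * n)) (Fin (2 * n)) ℂ := (chevE n i)ᵀ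

/-- The Tits generators `exp((π/2) (f_i - e_i))`, as matrices. -/
def titsGen (n : ℕ) (i : Fin n) : Matrix (Fin (2 * n)) (Fin (2 * n)) ℂ :=
  NormedSpace.exp ((Real.pi / 2 : ℂ) • (chevF n i - chevE n i))

/-- The Tits group of `Sp_{2n}(ℂ)`: the subgroup of the normalizer of the maximal torus generated
by the Tits generators. -/
def titsGroup (n : ℕ) : Subgroup (spNormalizer n) :=
  Subgroup.closure {g | ∃ i : Fin n,
    (((g : Sp n) : GL (Fin (2 * n)) ℂ) : Matrix (Fin (2 * n)) (Fin (2 * n)) ℂ) = titsGen n i}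

/-- The number `i` of the coordinate `ε_i` of the torus of `Sp_{2n}` to which the diagonal
position `a` belongs: positions `n-1-i` and `n+i` belong to `ε_i`. -/
def slot (n : ℕ) (a : Fin (2 * n)) : Fin n :=
  if h : (a : ℕ) < n then ⟨n - 1 - a, by omega⟩ else ⟨a - n, by omega⟩

/-- The element of the torus of `Sp_{2n}(ℂ)` with coordinates `z_0, …, z_{n-1}`, i.e.
`diag(z_{n-1}, …, z_0, z_0⁻¹, …, z_{n-1}⁻¹)`. -/
def torusElt (n : ℕ) (z : Fin n → ℂˣ) : GL (Fin (2 * n)) ℂ :=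
  diagHom (2 * n) ℂ fun a => if (a : ℕ) < n then z (slot n a) else (z (slot n a))⁻¹

/-- `ℤ/2ℤ`, as the Galois group of `ℂ` over `ℝ`. -/
abbrev GalCR : Type := ℂ ≃ₐ[ℝ] ℂ

open Classical in
/-- `ℤ/2ℤ = Gal(ℂ/ℝ)` acting on `ℂ^*` by inversion. -/
def signAct (s : GalCR) (z : ℂˣ) : ℂˣ := if s = 1 then z else z⁻¹

end

end QuatWeyl

namespace QuatWeyl

noncomputable section

/-! ### Unit quaternions, `SU_2` and `SO_3` -/

/-! Both extensions are compared with one group, `𝔖_n ⋉ Q^n`, where `Q = {±1, ±j}` (`quarterGroup`)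
is the preimage under `π` of the two-element group `γ(Gal(ℂ/ℝ))`.

On the quaternionic side, the normalizer of the diagonal subgroup consists of the monomial matrices,
because it must carry `diag(1, …, n)`, with distinct central entries, to a diagonal matrix
(`normalizer_diagSubgroup`). Positive real factors act trivially under conjugation, so unit
quaternions already induce every automorphism (`extToWeyl_surjective`), and what acts trivially is
the kernel of `π^n` (`ker_extToWeyl`). Surjectivity of `π` is an explicit Skolem–Noether argument
(`spin_surjective`). The preimage of the symplectic Weyl group is then `𝔖_n ⋉ Q^n`, by
`mem_quarterGroup_iff`.

On the symplectic side, `ℂ^{2n}` is a sum of `n` planes, one for each coordinate `z_i`. After a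
change of signs the form is the same on each plane, so `𝔖_n ⋉ Q^n` acts by symplectic matrices, with
`j` a quarter turn of its plane (`planeHom_mem_Sp`). This group surjects onto the Weyl group, since
a regular torus element detects signed permutations, and it meets the torus in the `2`-torsion
(`planeLift_mem_torus_iff`). The identity `exp((π/2)X) = 1 + X + X²` for `X³ = -X` makes the Tits
generators explicit: the long one is `j` in the first plane, the short ones are adjacent
transpositions with one sign (`planeHom_longLift`, `planeHom_shortLift`). These generate `𝔖_n ⋉
Q^n`, which is therefore the Tits group (`range_planeLift`). The two descriptions are compatible
with the projections because `γ` composed with `Q → Gal(ℂ/ℝ)` is `π` on `Q`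
(`galToSO3_quarterToGal`). -/

theorem mem_unitary_iff_normSq {q : ℍ[ℝ]} : q ∈ unitary ℍ[ℝ] ↔ normSq q = 1 := by
  rw [Unitary.mem_iff, star_mul_self, self_mul_star, and_self, ← coe_one, coe_inj]

theorem UnitQuat.sq_sum (q : UnitQuat) : (q : ℍ[ℝ]).re ^ 2 + (q : ℍ[ℝ]).imI ^ 2 +
    (q : ℍ[ℝ]).imJ ^ 2 + (q : ℍ[ℝ]).imK ^ 2 = 1 := by
  rw [← normSq_def']
  exact mem_unitary_iff_normSq.1 q.2

theorem quatMatrix_mul (p q : ℍ[ℝ]) : quatMatrix (p * q) = quatMatrix p * quatMatrix q := by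
  ext r s
  fin_cases r <;> fin_cases s <;>
    simp [quatMatrix, Matrix.mul_apply, Complex.ext_iff] <;> constructor <;> ring

theorem quatMatrix_star (q : ℍ[ℝ]) : quatMatrix (star q) = star (quatMatrix q) := by
  ext r s
  fin_cases r <;> fin_cases s <;>
    simp [quatMatrix, Matrix.star_apply, Complex.ext_iff]

theorem quatMatrix_one : quatMatrix 1 = 1 := by
  ext r s
  fin_cases r <;> fin_cases s <;> simp [quatMatrix, Complex.ext_iff]

theorem quatMatrix_det (q : ℍ[ℝ]) : (quatMatrix q).det = ((normSq q : ℝ) : ℂ) := by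
  rw [Matrix.det_fin_two, normSq_def']
  simp [quatMatrix, Complex.ext_iff, pow_two]
  constructor <;> ring

theorem quatMatrix_injective : Function.Injective quatMatrix := by
  intro p q h
  have h0 := congrFun (congrFun h 0) 0
  have h1 := congrFun (congrFun h 0) 1
  simp [quatMatrix] at h0 h1
  ext <;> tauto

/-- The standard representation of the unit quaternions by special unitary matrices. -/
def unitQuatToSU2 : UnitQuat →* SU2 where
  toFun q := ⟨quatMatrix q, by
    rw [Matrix.mem_specialUnitaryGroup_iff, Matrix.mem_unitaryGroup_iff, ← quatMatrix_star,
      ← quatMatrix_mul, Unitary.mul_star_self_of_mem q.2, quatMatrix_det,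
      mem_unitary_iff_normSq.1 q.2]
    exact ⟨quatMatrix_one, by simp⟩⟩
  map_one' := Subtype.ext quatMatrix_one
  map_mul' p q := Subtype.ext (quatMatrix_mul p q)

theorem unitQuatToSU2_bijective : Function.Bijective unitQuatToSU2 := by
  constructor
  · intro p q h
    exact Subtype.ext (quatMatrix_injective (congrArg Subtype.val h))
  · rintro ⟨U, hU⟩
    obtain ⟨h1, h2⟩ := Matrix.mem_specialUnitaryGroup_iff.1 hU
    -- For determinant one the inverse is the adjugate, so unitarity expresses the second row
    -- through the first.
    have hstar : star U = U.adjugate := by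
      have h3 := Matrix.mul_adjugate U
      rw [h2, one_smul] at h3
      rw [Matrix.mem_unitaryGroup_iff'] at h1
      exact left_inv_eq_right_inv h1 h3
    have h00 := congrFun (congrFun hstar 0) 0
    have h01 := congrFun (congrFun hstar 0) 1
    simp [Matrix.adjugate_fin_two, Matrix.star_apply] at h00 h01
    have hq : quatMatrix ⟨(U 0 0).re, (U 0 0).im, (U 0 1).re, (U 0 1).im⟩ = U := by
      ext r s
      fin_cases r <;> fin_cases s
      · simp [quatMatrix]
      · simp [quatMatrix]
      · have := congrArg (starRingEnd ℂ) h01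
        simp at this
        simp [quatMatrix, this, Complex.ext_iff]
      · simp [quatMatrix, ← h00, Complex.ext_iff]
    refine ⟨⟨_, mem_unitary_iff_normSq.2 ?_⟩, Subtype.ext hq⟩
    have := quatMatrix_det ⟨(U 0 0).re, (U 0 0).im, (U 0 1).re, (U 0 1).im⟩
    rw [hq, h2] at this
    exact_mod_cast this.symm

/-- The isomorphism of the unit quaternions with `SU_2`. -/
def unitQuatEquivSU2 : UnitQuat ≃* SU2 :=
  MulEquiv.ofBijective unitQuatToSU2 unitQuatToSU2_bijective

theorem rotAct_spin (q : UnitQuat) (x : ℍ[ℝ]) :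
    rotAct (spin q) x = q * x * star (q : ℍ[ℝ]) := by
  have h := UnitQuat.sq_sum q
  have h1 : (spin q : Matrix (Fin 3) (Fin 3) ℝ) = adMatrix q := rfl
  rw [rotAct, h1, adMatrix_eq]
  ext
  · simp
    linear_combination (-x.re) * h
  all_goals
    simp [imCoord]
    ring

theorem rotAct_coe (R : SO3) (a : ℝ) : rotAct R (a : ℍ[ℝ]) = a := by
  have h : imCoord (a : ℍ[ℝ]) = 0 := by ext t; fin_cases t <;> rfl
  ext <;> simp [rotAct, h]

theorem rotAct_injective {R R' : SO3} (h : ∀ x, rotAct R x = rotAct R' x) : R = R' := by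
  apply Subtype.ext
  ext r s
  have h1 := h (imQuat (Pi.single s 1))
  have h2 : imCoord (imQuat (Pi.single s 1)) = Pi.single s 1 := by
    ext t; fin_cases t <;> rfl
  simp only [rotAct, h2, Matrix.mulVec_single_one] at h1
  have h3 := congrArg imCoord h1
  have h4 := congrFun h3 r
  fin_cases r <;> simpa [imCoord] using h4

theorem range_signHom : signHom.range = spin.ker := by
  ext q
  rw [MonoidHom.mem_ker]
  constructor
  · rintro ⟨e, rfl⟩
    apply rotAct_injective
    intro x
    rw [rotAct_spin]
    have h2 : ((signHom e : UnitQuat) : ℍ[ℝ]) = (((e : ℝˣ) : ℝ) : ℍ[ℝ]) := rfl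
    have h3 := Unitary.mul_star_self_of_mem (signHom e).2
    rw [h2] at h3 ⊢
    rw [Quaternion.coe_commutes, mul_assoc, h3]
    ext <;> simp [rotAct, imCoord]
  · intro h
    have h1 := UnitQuat.sq_sum q
    have h2 : adMatrix (q : ℍ[ℝ]) = 1 := congrArg Subtype.val h
    rw [adMatrix_eq] at h2
    -- Each diagonal entry, subtracted from the norm equation, leaves twice a sum of two squares
    -- equal to zero.
    have e0 := congrFun (congrFun h2 0) 0
    have e1 := congrFun (congrFun h2 1) 1
    have e2 := congrFun (congrFun h2 2) 2
    simp at e0 e1 e2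
    have hI : (q : ℍ[ℝ]).imI = 0 := by nlinarith
    have hJ : (q : ℍ[ℝ]).imJ = 0 := by nlinarith
    have hK : (q : ℍ[ℝ]).imK = 0 := by nlinarith
    rw [hI, hJ, hK] at h1
    have h5 : (q : ℍ[ℝ]).re ^ 2 = 1 := by linarith
    have h6 : (q : ℍ[ℝ]).re ≠ 0 := by
      rintro h0
      rw [h0] at h5
      norm_num at h5
    refine ⟨⟨Units.mk0 _ h6, ?_⟩, ?_⟩
    · rw [mem_rootsOfUnity']
      exact h5
    · apply Subtype.ext
      change (((q : ℍ[ℝ]).re : ℝ) : ℍ[ℝ]) = q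
      ext <;> simp [hI, hJ, hK]

theorem signHom_injective : Function.Injective signHom := by
  intro a b h
  have h1 : (((a : ℝˣ) : ℝ) : ℍ[ℝ]) = (((b : ℝˣ) : ℝ) : ℍ[ℝ]) := congrArg Subtype.val h
  exact Subtype.ext (Units.ext (Quaternion.coe_inj.1 h1))

/-- The average of `a` intertwining the imaginary units with the triple `u, v, w`. -/
def intertwiner (u v w a : ℍ[ℝ]) : ℍ[ℝ] :=
  a - u * a * imQuat ![1, 0, 0] - v * a * imQuat ![0, 1, 0] - w * a * imQuat ![0, 0, 1]

theorem adMatrix_of_intertwines (q : UnitQuat) (R : SO3)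
    (h : ∀ s, imQuat (fun r => (R : Matrix (Fin 3) (Fin 3) ℝ) r s) * q =
      (q : ℍ[ℝ]) * imQuat (Pi.single s 1)) : spin q = R := by
  apply Subtype.ext
  ext r s
  change imCoord (q * imQuat (Pi.single s 1) * star (q : ℍ[ℝ])) r = _
  rw [← h s, mul_assoc, Unitary.mul_star_self_of_mem q.2, mul_one]
  fin_cases r <;> rfl

/-- The real-linear map `a ↦ intertwiner u v w a` has trace `4`: the identity contributes `4`, and
`a ↦ u a i` has trace `4 Re(u) Re(i) = 0`, likewise for the other two terms. The four evaluations
below are its diagonal entries in the basis `1, i, j, k`. -/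
theorem exists_intertwiner_ne_zero (u v w : ℍ[ℝ]) (hu : u.re = 0) (hv : v.re = 0)
    (hw : w.re = 0) : ∃ a, intertwiner u v w a ≠ 0 := by
  by_contra! h
  have h0 := congrArg (·.re) (h 1)
  have h1 := congrArg (·.imI) (h (imQuat ![1, 0, 0]))
  have h2 := congrArg (·.imJ) (h (imQuat ![0, 1, 0]))
  have h3 := congrArg (·.imK) (h (imQuat ![0, 0, 1]))
  simp [intertwiner, hu, hv, hw] at h0 h1 h2 h3
  linarith

/-- `intertwiner` is an average over the quaternion group modulo its centre, `a + u a i⁻¹ + v a j⁻¹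
+ w a k⁻¹`, so left multiplication by `u`, `v`, `w` permutes its terms. -/
theorem intertwiner_spec (u v w a : ℍ[ℝ]) (huu : u * u = -1) (hvv : v * v = -1) (hww : w * w = -1)
    (huv : u * v = w) (hvw : v * w = u) (hwu : w * u = v) (hvu : v * u = -w) (hwv : w * v = -u)
    (huw : u * w = -v) :
    u * intertwiner u v w a = intertwiner u v w a * imQuat ![1, 0, 0] ∧
    v * intertwiner u v w a = intertwiner u v w a * imQuat ![0, 1, 0] ∧
    w * intertwiner u v w a = intertwiner u v w a * imQuat ![0, 0, 1] := by
  have ii : imQuat ![1, 0, 0] * imQuat ![1, 0, 0] = -1 := by ext <;> simp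
  have jj : imQuat ![0, 1, 0] * imQuat ![0, 1, 0] = -1 := by ext <;> simp
  have kk : imQuat ![0, 0, 1] * imQuat ![0, 0, 1] = -1 := by ext <;> simp
  have ij : imQuat ![1, 0, 0] * imQuat ![0, 1, 0] = imQuat ![0, 0, 1] := by ext <;> simp
  have ji : imQuat ![0, 1, 0] * imQuat ![1, 0, 0] = -imQuat ![0, 0, 1] := by ext <;> simp
  have jk : imQuat ![0, 1, 0] * imQuat ![0, 0, 1] = imQuat ![1, 0, 0] := by ext <;> simp
  have kj : imQuat ![0, 0, 1] * imQuat ![0, 1, 0] = -imQuat ![1, 0, 0] := by ext <;> simp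
  have ki : imQuat ![0, 0, 1] * imQuat ![1, 0, 0] = imQuat ![0, 1, 0] := by ext <;> simp
  have ik : imQuat ![1, 0, 0] * imQuat ![0, 0, 1] = -imQuat ![0, 1, 0] := by ext <;> simp
  simp only [intertwiner, mul_sub, sub_mul, mul_assoc, ii, jj, kk, ij, ji, jk, kj, ki, ik]
  simp only [← mul_assoc, huu, hvv, hww, huv, hvw, hwu, hvu, hwv, huw]
  refine ⟨?_, ?_, ?_⟩ <;> noncomm_ring

/-- The columns of a rotation are imaginary quaternions with the same multiplication table as `i, j,
k`. A nonzero intertwiner of the two triples, scaled to norm one, is a preimage. -/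
theorem spin_surjective : Function.Surjective spin := by
  intro R
  set M := (R : Matrix (Fin 3) (Fin 3) ℝ) with hM
  obtain ⟨h1, h2⟩ := Matrix.mem_specialOrthogonalGroup_iff.1 R.2
  -- This says that each column is the cross product of the other two; with orthonormality it yields
  -- the whole multiplication table.
  have hadj : Mᵀ = M.adjugate := by
    have h3 := Matrix.mul_adjugate M
    rw [h2, one_smul] at h3
    rw [Matrix.mem_orthogonalGroup_iff'] at h1
    exact left_inv_eq_right_inv h1 h3
  have horth : Mᵀ * M = 1 := (Matrix.mem_orthogonalGroup_iff' _ _).1 h1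
  have o : ∀ r s, M 0 r * M 0 s + M 1 r * M 1 s + M 2 r * M 2 s = (1 : Matrix _ _ ℝ) r s := by
    intro r s
    have := congrFun (congrFun horth r) s
    simpa [Matrix.mul_apply, Fin.sum_univ_three] using this
  have c : ∀ r s, M s r = M.adjugate r s := fun r s => congrFun (congrFun hadj r) s
  rw [Matrix.adjugate_fin_three] at c
  have o00 := o 0 0
  have o11 := o 1 1
  have o22 := o 2 2
  have o01 := o 0 1
  have o02 := o 0 2
  have o12 := o 1 2
  have c00 := c 0 0
  have c01 := c 0 1
  have c02 := c 0 2
  have c10 := c 1 0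
  have c11 := c 1 1
  have c12 := c 1 2
  have c20 := c 2 0
  have c21 := c 2 1
  have c22 := c 2 2
  simp at o00 o11 o22 o01 o02 o12 c00 c01 c02 c10 c11 c12 c20 c21 c22
  let col : Fin 3 → ℍ[ℝ] := fun s => imQuat fun r => M r s
  obtain ⟨a, ha⟩ := exists_intertwiner_ne_zero (col 0) (col 1) (col 2) rfl rfl rfl
  have spec := intertwiner_spec (col 0) (col 1) (col 2) a
    (by ext <;> simp [col] <;> linarith) (by ext <;> simp [col] <;> linarith)
    (by ext <;> simp [col] <;> linarith) (by ext <;> simp [col] <;> linarith)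
    (by ext <;> simp [col] <;> linarith) (by ext <;> simp [col] <;> linarith)
    (by ext <;> simp [col] <;> linarith) (by ext <;> simp [col] <;> linarith)
    (by ext <;> simp [col] <;> linarith)
  set q := intertwiner (col 0) (col 1) (col 2) a
  have hn : ‖q‖ ≠ 0 := norm_ne_zero_iff.2 ha
  have hunit : ((‖q‖⁻¹ : ℝ) : ℍ[ℝ]) * q ∈ unitary ℍ[ℝ] := by
    rw [mem_unitary_iff_normSq, map_mul, normSq_coe, normSq_eq_norm_mul_self]
    field_simp
  have key : ∀ x y : ℍ[ℝ], x * q = q * y →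
      x * (((‖q‖⁻¹ : ℝ) : ℍ[ℝ]) * q) = ((‖q‖⁻¹ : ℝ) : ℍ[ℝ]) * q * y := by
    intro x y hxy
    rw [← mul_assoc, ← Quaternion.coe_commutes, mul_assoc, hxy, mul_assoc]
  refine ⟨⟨_, hunit⟩, adMatrix_of_intertwines _ _ ?_⟩
  intro s
  apply key
  fin_cases s
  · convert spec.1 using 3
    all_goals ext t; fin_cases t <;> rfl
  · convert spec.2.1 using 3
    all_goals ext t; fin_cases t <;> rfl
  · convert spec.2.2 using 3
    all_goals ext t; fin_cases t <;> rfl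

/-- The exact sequence `1 → μ_2 → SU_2 → SO_3 → 1`. -/
def spinExtension : GroupExtension Mu2 UnitQuat SO3 where
  inl := signHom
  rightHom := spin
  inl_injective := signHom_injective
  range_inl_eq_ker_rightHom := range_signHom
  rightHom_surjective := spin_surjective

/-! ### The Galois group of `ℂ` over `ℝ` -/

theorem galCR_eq (s : GalCR) : s = 1 ∨ s = Complex.conjAe := by
  rcases Complex.real_algHom_eq_id_or_conj (s : ℂ →ₐ[ℝ] ℂ) with h | h
  · left; ext z; exact DFunLike.congr_fun h z
  · right; ext z; exact DFunLike.congr_fun h z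

theorem conjAe_ne_one : (Complex.conjAe : GalCR) ≠ 1 := by
  intro h
  have := DFunLike.congr_fun h Complex.I
  simp [Complex.ext_iff] at this
  norm_num at this

theorem conjAe_mul_self : (Complex.conjAe : GalCR) * Complex.conjAe = 1 := by
  ext z; simp

theorem rotAct_spin_quatJ (x : ℍ[ℝ]) :
    rotAct (spin quatJ) x = ⟨x.re, -x.imI, x.imJ, -x.imK⟩ := by
  rw [rotAct_spin]
  have h : (quatJ : ℍ[ℝ]) = imQuat ![0, 1, 0] := rfl
  rw [h]
  ext <;> simp

/-- Although `j` has order four, its square `-1` lies in the kernel; hence `γ` is a homomorphism on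
a group of order two. -/
theorem spin_quatJ_mul_self : spin quatJ * spin quatJ = 1 := by
  rw [← map_mul]
  have : quatJ * quatJ ∈ spin.ker := by
    rw [← range_signHom]
    refine ⟨⟨-1, by simp⟩, Subtype.ext ?_⟩
    change ((-1 : ℝ) : ℍ[ℝ]) = imQuat ![0, 1, 0] * imQuat ![0, 1, 0]
    ext <;> simp
  exact this

theorem spin_quatJ_ne_one : spin quatJ ≠ 1 := by
  intro h
  have h1 := rotAct_spin_quatJ (imQuat ![1, 0, 0])
  rw [h, ← map_one spin, rotAct_spin] at h1
  have := congrArg (·.imI) h1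
  simp at this
  norm_num at this

open Classical in
/-- The homomorphism `Gal(ℂ/ℝ) → SO_3` sending complex conjugation to `π(j)`. -/
def galToSO3 : GalCR →* SO3 where
  toFun s := if s = 1 then 1 else spin quatJ
  map_one' := if_pos rfl
  map_mul' s t := by
    have h := conjAe_ne_one
    rcases galCR_eq s with rfl | rfl <;> rcases galCR_eq t with rfl | rfl <;>
      simp [h, conjAe_mul_self, spin_quatJ_mul_self]

theorem galToSO3_conjAe : galToSO3 Complex.conjAe = spin quatJ := if_neg conjAe_ne_one

theorem galToSO3_injective : Function.Injective galToSO3 := by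
  rw [injective_iff_map_eq_one]
  intro s hs
  rcases galCR_eq s with rfl | rfl
  · rfl
  · exact absurd (galToSO3_conjAe.symm.trans hs) spin_quatJ_ne_one

theorem rotAct_galToSO3 (s : GalCR) (z : ℂ) :
    rotAct (galToSO3 s) (z : ℍ[ℝ]) = ((s z : ℂ) : ℍ[ℝ]) := by
  rcases galCR_eq s with rfl | rfl
  · rw [map_one, ← map_one spin, rotAct_spin]
    simp
  · rw [galToSO3_conjAe, rotAct_spin_quatJ]
    ext <;> simp [coeComplex]

end

noncomputable section

/-! ### Wreath products -/

namespace Wr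

variable {n : ℕ} {K L : Type*} [Group K] [Group L]

theorem ext_iff' {x y : Wr n K} : x = y ↔ (∀ i, x.left i = y.left i) ∧ x.right = y.right := by
  rw [SemidirectProduct.ext_iff, funext_iff]

theorem map_injective {f : K →* L} (hf : Function.Injective f) :
    Function.Injective (Wr.map n f) := by
  intro x y h
  rw [ext_iff'] at h ⊢
  exact ⟨fun i => hf (h.1 i), h.2⟩

theorem map_surjective {f : K →* L} (hf : Function.Surjective f) :
    Function.Surjective (Wr.map n f) := by
  intro y
  choose k hk using fun i => hf (y.left i)
  exact ⟨⟨k, y.right⟩, ext_iff'.2 ⟨hk, rfl⟩⟩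

theorem map_eq_one_iff {f : K →* L} {x : Wr n K} :
    Wr.map n f x = 1 ↔ (∀ i, f (x.left i) = 1) ∧ x.right = 1 := ext_iff'

theorem inv_left (x : Wr n K) (i : Fin n) : (x⁻¹).left i = (x.left (x.right i))⁻¹ := rfl

theorem mul_left (x y : Wr n K) (i : Fin n) :
    (x * y).left i = x.left i * y.left (x.right⁻¹ i) := rfl

/-- If `f : J → K` and `g : K → L` form an exact sequence, then `J^n` maps onto the kernel of
`𝔖_n ⋉ K^n → 𝔖_n ⋉ L^n`. -/
theorem range_inl_comp_piMap {J : Type*} [Group J] {f : J →* K} {g : K →* L}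
    (h : f.range = g.ker) :
    ((SemidirectProduct.inl : _ →* Wr n K).comp (piMap n f)).range = (Wr.map n g).ker := by
  ext x
  rw [MonoidHom.mem_ker, map_eq_one_iff]
  constructor
  · rintro ⟨k, rfl⟩
    refine ⟨fun i => ?_, rfl⟩
    have : f (k i) ∈ g.ker := h ▸ ⟨k i, rfl⟩
    exact this
  · rintro ⟨h1, h2⟩
    have h3 : ∀ i, ∃ j, f j = x.left i := fun i => by
      have : x.left i ∈ f.range := h ▸ h1 i
      exact this
    choose k hk using h3
    exact ⟨k, ext_iff'.2 ⟨hk, h2.symm⟩⟩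

theorem inl_comp_piMap_injective {f : K →* L} (hf : Function.Injective f) :
    Function.Injective ((SemidirectProduct.inl : _ →* Wr n L).comp (piMap n f)) := by
  intro a b h
  exact funext fun i => hf ((ext_iff'.1 h).1 i)

end Wr

/-! ### Monomial matrices and the normalizer of the diagonal subgroup -/

section Monomial

variable {n : ℕ} {A : Type*}

theorem monomialHom_apply [Ring A] (x : Wr n Aˣ) (i j : Fin n) :
    (monomialHom n A x : Matrix (Fin n) (Fin n) A) i j =
      if i = x.right j then (x.left i : A) else 0 := rfl

theorem diagHom_coe [Ring A] (d : Fin n → Aˣ) :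
    (diagHom n A d : Matrix (Fin n) (Fin n) A) = diagonal fun i => (d i : A) := rfl

theorem monomialHom_inl [Ring A] (d : Fin n → Aˣ) :
    monomialHom n A (SemidirectProduct.inl d) = diagHom n A d := by
  ext i j
  rw [monomialHom_apply, diagHom_coe]
  by_cases h : i = j
  · subst h; simp
  · simp [h]

theorem monomialHom_conj_diagHom [Ring A] (x : Wr n Aˣ) (d : Fin n → Aˣ) :
    monomialHom n A x * diagHom n A d * (monomialHom n A x)⁻¹ =
      diagHom n A fun i => x.left i * d (x.right⁻¹ i) * (x.left i)⁻¹ := by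
  -- Every factor comes from the wreath product, so the identity is checked there.
  rw [mul_inv_eq_iff_eq_mul, ← monomialHom_inl, ← monomialHom_inl, ← map_mul, ← map_mul]
  congr 1
  refine Wr.ext_iff'.2 ⟨fun i => ?_, ?_⟩
  · simp [Wr.mul_left]
  · simp

theorem monomialHom_injective [Ring A] [Nontrivial A] : Function.Injective (monomialHom n A) := by
  rw [injective_iff_map_eq_one]
  intro x hx
  have h : ∀ i j, (if i = x.right j then (x.left i : A) else 0) = (1 : Matrix _ _ A) i j :=
    fun i j => by rw [← monomialHom_apply, hx]; rfl
  have hr : x.right = 1 := by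
    ext j : 1
    by_contra hj
    have := h (x.right j) j
    rw [if_pos rfl, Matrix.one_apply_ne (i := x.right j) (j := j) hj] at this
    exact (x.left _).ne_zero this
  refine Wr.ext_iff'.2 ⟨fun i => Units.ext ?_, hr⟩
  have := h i i
  rw [hr] at this
  simpa using this

/-- An invertible matrix that carries a diagonal matrix with distinct central entries to a diagonal
matrix is monomial. -/
theorem exists_monomialHom_eq [DivisionRing A] (g : GL (Fin n) A) (t t' : Fin n → A)
    (ht : Function.Injective t) (hc : ∀ i x, Commute (t i) x)
    (h : (g : Matrix (Fin n) (Fin n) A) * diagonal t = diagonal t' * g) :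
    ∃ x, monomialHom n A x = g := by
  -- Compare the `(a, b)` entries on both sides; centrality of `t b` moves it past the entry of `g`.
  have h1 : ∀ a b, (g : Matrix (Fin n) (Fin n) A) a b ≠ 0 → t b = t' a := by
    intro a b hab
    have := congrFun (congrFun h a) b
    rw [Matrix.mul_diagonal, Matrix.diagonal_mul, ← (hc b _).eq] at this
    exact mul_right_cancel₀ hab this
  have hrow : ∀ a, ∃ b, (g : Matrix (Fin n) (Fin n) A) a b ≠ 0 := by
    intro a
    by_contra! h0
    have := congrFun (congrFun (Units.mul_inv g) a) a
    rw [Matrix.mul_apply, Finset.sum_eq_zero fun b _ => by rw [h0 b, zero_mul]] at this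
    simp at this
  have hcol : ∀ b, ∃ a, (g : Matrix (Fin n) (Fin n) A) a b ≠ 0 := by
    intro b
    by_contra! h0
    have := congrFun (congrFun (Units.inv_mul g) b) b
    rw [Matrix.mul_apply, Finset.sum_eq_zero fun a _ => by rw [h0 a, mul_zero]] at this
    simp at this
  choose f hf using hrow
  -- Distinctness of the `t i` leaves one nonzero entry in each row, while invertibility puts one in
  -- each column.
  have hf' : ∀ a b, (g : Matrix (Fin n) (Fin n) A) a b ≠ 0 → b = f a := fun a b hab =>
    ht ((h1 a b hab).trans (h1 a (f a) (hf a)).symm)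
  have hsurj : Function.Surjective f := fun b => by
    obtain ⟨a, ha⟩ := hcol b
    exact ⟨a, (hf' a b ha).symm⟩
  let σ := Equiv.ofBijective f (Finite.injective_iff_bijective.1
    (Finite.injective_iff_surjective.2 hsurj))
  refine ⟨⟨fun a => Units.mk0 _ (hf a), σ.symm⟩, ?_⟩
  ext a b
  rw [monomialHom_apply]
  by_cases hab : a = σ.symm b
  · have : b = f a := by rw [hab]; exact (σ.apply_symm_apply b).symm
    rw [if_pos hab, this]
    rfl
  · rw [if_neg hab]
    by_contra h0
    exact hab (σ.symm_apply_eq.2 (hf' a b (Ne.symm h0))).symm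

theorem toDiag_coe [Ring A] (d : Fin n → Aˣ) :
    (toDiag n A d : GL (Fin n) A) = diagHom n A d := rfl

theorem toDiag_surjective [Ring A] : Function.Surjective (toDiag n A) :=
  MonoidHom.rangeRestrict_surjective _

theorem monomialHom_mem_normalizer [Ring A] (x : Wr n Aˣ) :
    monomialHom n A x ∈ Subgroup.normalizer (diagSubgroup n A : Set (GL (Fin n) A)) := by
  have key : ∀ (y : Wr n Aˣ) (g), g ∈ diagSubgroup n A →
      monomialHom n A y * g * (monomialHom n A y)⁻¹ ∈ diagSubgroup n A := by
    rintro y _ ⟨d, rfl⟩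
    rw [monomialHom_conj_diagHom]
    exact ⟨_, rfl⟩
  rw [Subgroup.mem_normalizer_iff]
  refine fun g => ⟨key x g, fun hg => ?_⟩
  have := key x⁻¹ _ hg
  rw [map_inv] at this
  simpa [mul_assoc] using this

/-- A single test element suffices: `diag(1, …, n)` has central entries, which are distinct and
nonzero in characteristic zero. -/
theorem normalizer_diagSubgroup [DivisionRing A] [CharZero A] :
    Subgroup.normalizer (diagSubgroup n A : Set (GL (Fin n) A)) = (monomialHom n A).range := by
  apply le_antisymm
  · intro g hg
    let t : Fin n → Aˣ := fun i => Units.mk0 (((i : ℕ) + 1 : ℕ) : A) (Nat.cast_ne_zero.2 (by omega))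
    obtain ⟨t', ht'⟩ := (Subgroup.mem_normalizer_iff.1 hg (diagHom n A t)).1 ⟨t, rfl⟩
    apply exists_monomialHom_eq g (fun i => t i) (fun i => t' i)
    · intro i j hij
      have : (i : ℕ) + 1 = (j : ℕ) + 1 := Nat.cast_injective (R := A) hij
      exact Fin.ext (by omega)
    · exact fun i x => Nat.cast_commute _ _
    · rw [eq_mul_inv_iff_mul_eq] at ht'
      exact (congrArg Units.val ht').symm
  · rintro _ ⟨x, rfl⟩
    exact monomialHom_mem_normalizer x

/-- The action of monomial matrices on the diagonal subgroup. -/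
def monomialToWeyl (n : ℕ) (A : Type*) [Ring A] : Wr n Aˣ →* WeylGroup n A :=
  (toWeyl n A).comp ((monomialHom n A).codRestrict _ monomialHom_mem_normalizer)

theorem monomialToWeyl_apply [Ring A] (x : Wr n Aˣ) (d : Fin n → Aˣ) :
    (monomialToWeyl n A x : MulAut (diagSubgroup n A)) (toDiag n A d) =
      toDiag n A fun i => x.left i * d (x.right⁻¹ i) * (x.left i)⁻¹ :=
  Subtype.ext (monomialHom_conj_diagHom x d)

theorem monomialToWeyl_surjective [DivisionRing A] [CharZero A] :
    Function.Surjective (monomialToWeyl n A) := by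
  intro w
  obtain ⟨⟨g, hg⟩, rfl⟩ := MonoidHom.rangeRestrict_surjective _ w
  have hg' := hg
  rw [normalizer_diagSubgroup] at hg'
  obtain ⟨x, rfl⟩ := hg'
  exact ⟨x, rfl⟩

theorem diagHom_injective [Ring A] : Function.Injective (diagHom n A) := by
  intro d e h
  have := congrArg Units.val h
  rw [diagHom_coe, diagHom_coe] at this
  exact funext fun i => Units.ext (congrFun (Matrix.diagonal_injective this) i)

theorem WeylGroup.ext_toDiag [Ring A] {v w : WeylGroup n A}
    (h : ∀ d, (v : MulAut (diagSubgroup n A)) (toDiag n A d) =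
      (w : MulAut (diagSubgroup n A)) (toDiag n A d)) : v = w := by
  apply Subtype.ext
  apply MulEquiv.ext
  intro g
  obtain ⟨d, rfl⟩ := toDiag_surjective g
  exact h d

end Monomial

/-! ### The quaternionic Weyl group -/

/-- The map from the extended group to the quaternionic Weyl group. -/
def extToWeyl (n : ℕ) : ExtWeyl n →* WeylGroup n ℍ[ℝ] :=
  (monomialToWeyl n ℍ[ℝ]).comp (Wr.map n Unitary.toUnits)

variable {n : ℕ}

theorem extToWeyl_apply (x : ExtWeyl n) (d : Fin n → (ℍ[ℝ])ˣ) :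
    ((((extToWeyl n x : MulAut (diagSubgroup n ℍ[ℝ])) (toDiag n ℍ[ℝ] d) :
      diagSubgroup n ℍ[ℝ]) : GL (Fin n) ℍ[ℝ]) : Matrix (Fin n) (Fin n) ℍ[ℝ]) =
    diagonal fun i => rotAct (spin (x.left i)) (d (x.right⁻¹ i)) := by
  have h : (extToWeyl n x : MulAut (diagSubgroup n ℍ[ℝ])) (toDiag n ℍ[ℝ] d) = _ :=
    monomialToWeyl_apply (Wr.map n Unitary.toUnits x) d
  rw [h, toDiag_coe, diagHom_coe]
  congr 1
  ext1 i
  rw [rotAct_spin]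
  rfl

/-- Rotations fix real numbers, so a diagonal matrix with distinct real entries sees only the
permutation. Once that is trivial, constant diagonal matrices show that every rotation is trivial.
-/
theorem ker_extToWeyl : (extToWeyl n).ker = (Wr.map n spin).ker := by
  ext x
  rw [MonoidHom.mem_ker, MonoidHom.mem_ker, Wr.map_eq_one_iff]
  constructor
  · intro hx
    have h : ∀ (d : Fin n → (ℍ[ℝ])ˣ) i,
        rotAct (spin (x.left i)) (d (x.right⁻¹ i)) = (d i : ℍ[ℝ]) := by
      intro d i
      have h1 := extToWeyl_apply x d
      rw [hx] at h1
      exact (congrFun (Matrix.diagonal_injective h1) i).symm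
    have hr : x.right = 1 := by
      rw [← inv_eq_one]
      ext i : 1
      have h1 := h (fun j => Units.mk0 ((((j : ℕ) + 1 : ℕ) : ℝ) : ℍ[ℝ]) (by
        rw [Ne, ← coe_zero, coe_inj]; positivity)) i
      simp only [Units.val_mk0, rotAct_coe, coe_inj, Nat.cast_inj] at h1
      exact Fin.ext (by simpa using h1)
    refine ⟨fun i => ?_, hr⟩
    apply rotAct_injective
    intro u
    by_cases hu : u = 0
    · rw [hu, ← coe_zero, rotAct_coe, rotAct_coe]
    · have h1 := h (fun _ => Units.mk0 u hu) i
      rw [Units.val_mk0] at h1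
      rw [h1, ← map_one spin, rotAct_spin]
      simp
  · rintro ⟨h1, h2⟩
    apply WeylGroup.ext_toDiag
    intro d
    apply Subtype.ext
    apply Units.ext
    rw [extToWeyl_apply]
    change _ = diagonal fun i => (d i : ℍ[ℝ])
    congr 1
    ext1 i
    rw [h1, h2, ← map_one spin, rotAct_spin]
    simp

/-- Dividing each entry of a monomial matrix by its norm multiplies it by a central real scalar,
which does not change the conjugation action. -/
theorem extToWeyl_surjective : Function.Surjective (extToWeyl n) := by
  intro w
  have : CharZero ℍ[ℝ] := charZero_of_injective_algebraMap (algebraMap ℝ ℍ[ℝ]).injective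
  obtain ⟨x, rfl⟩ := monomialToWeyl_surjective w
  have hn : ∀ i, ‖(x.left i : ℍ[ℝ])‖ ≠ 0 := fun i => norm_ne_zero_iff.2 (x.left i).ne_zero
  let r : Fin n → (ℍ[ℝ])ˣ := fun i => Units.mk0 ((‖(x.left i : ℍ[ℝ])‖⁻¹ : ℝ) : ℍ[ℝ]) (by
    rw [Ne, ← coe_zero, coe_inj]; exact inv_ne_zero (hn i))
  have hr : ∀ i (u : (ℍ[ℝ])ˣ), r i * u = u * r i := fun i u =>
    Units.ext (Quaternion.coe_commutes _ _)
  let q : Fin n → UnitQuat := fun i => ⟨r i * x.left i, by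
    rw [mem_unitary_iff_normSq, map_mul, normSq_eq_norm_mul_self (x.left i : ℍ[ℝ]),
      Units.val_mk0, normSq_coe]
    have := hn i
    field_simp⟩
  have hq : ∀ i, Unitary.toUnits (q i) = r i * x.left i := fun i => Units.ext rfl
  refine ⟨⟨q, x.right⟩, WeylGroup.ext_toDiag fun d => ?_⟩
  rw [monomialToWeyl_apply]
  refine (monomialToWeyl_apply (Wr.map n Unitary.toUnits ⟨q, x.right⟩) d).trans ?_
  congr 1
  ext1 i
  change Unitary.toUnits (q i) * d (x.right⁻¹ i) * (Unitary.toUnits (q i))⁻¹ = _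
  rw [hq, _root_.mul_inv_rev, hr]
  simp only [mul_assoc]
  rw [← mul_assoc (d _), ← mul_assoc (r i), hr]
  simp [mul_assoc]

/-- The isomorphism of `𝔖_n ⋉ SO_3^n` with the quaternionic Weyl group. -/
def weylEquiv (n : ℕ) : Wr n SO3 ≃* WeylGroup n ℍ[ℝ] :=
  (QuotientGroup.quotientKerEquivOfSurjective _ (Wr.map_surjective spin_surjective)).symm.trans
    ((QuotientGroup.quotientMulEquivOfEq ker_extToWeyl.symm).trans
      (QuotientGroup.quotientKerEquivOfSurjective _ extToWeyl_surjective))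

/-- `weylEquiv` is a composite of first-isomorphism maps; this is the formula through which it is
computed, as `Wr.map n spin` is onto. -/
theorem weylEquiv_map_spin (x : ExtWeyl n) :
    weylEquiv n (Wr.map n spin x) = extToWeyl n x := by
  have h : (QuotientGroup.quotientKerEquivOfSurjective (Wr.map n spin)
      (Wr.map_surjective spin_surjective)).symm (Wr.map n spin x) = QuotientGroup.mk x := by
    rw [MulEquiv.symm_apply_eq]
    rfl
  rw [weylEquiv, MulEquiv.trans_apply, h]
  rfl

theorem weylEquiv_apply (x : Wr n SO3) (d : Fin n → (ℍ[ℝ])ˣ) :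
    ((((weylEquiv n x : MulAut (diagSubgroup n ℍ[ℝ])) (toDiag n ℍ[ℝ] d) :
      diagSubgroup n ℍ[ℝ]) : GL (Fin n) ℍ[ℝ]) : Matrix (Fin n) (Fin n) ℍ[ℝ]) =
    diagonal fun i => rotAct (x.left i) (d (x.right⁻¹ i)) := by
  obtain ⟨y, rfl⟩ := Wr.map_surjective spin_surjective x
  rw [weylEquiv_map_spin, extToWeyl_apply]
  rfl

/-- The extension of the quaternionic Weyl group by `(μ_2)^n`. -/
def weylExtension (n : ℕ) :
    GroupExtension (Fin n → Mu2) (ExtWeyl n) (WeylGroup n ℍ[ℝ]) where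
  inl := extInl n
  rightHom := (weylEquiv n).toMonoidHom.comp (Wr.map n spin)
  inl_injective := Wr.inl_comp_piMap_injective signHom_injective
  range_inl_eq_ker_rightHom := by
    rw [extInl, Wr.range_inl_comp_piMap range_signHom]
    ext x
    simp [MonoidHom.mem_ker]
  rightHom_surjective := (weylEquiv n).surjective.comp (Wr.map_surjective spin_surjective)

theorem extEmbedding_injective : Function.Injective (extEmbedding n) :=
  monomialHom_injective.comp (Wr.map_injective fun _ _ h => Subtype.ext (congrArg Units.val h))

theorem extEmbedding_mem_normalizer (x : ExtWeyl n) : extEmbedding n x ∈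
    Subgroup.normalizer (diagSubgroup n ℍ[ℝ] : Set (GL (Fin n) ℍ[ℝ])) :=
  monomialHom_mem_normalizer _

theorem toWeyl_extEmbedding (x : ExtWeyl n) :
    toWeyl n ℍ[ℝ] ⟨extEmbedding n x, extEmbedding_mem_normalizer x⟩ =
      (weylExtension n).rightHom x :=
  (weylEquiv_map_spin x).symm

end

noncomputable section

/-! ### The group `{±1, ±j}` -/

/-- The cyclic group of order four generated by the quaternion unit `j`. -/
def quarterGroup : Subgroup UnitQuat where
  -- Given norm one, the vanishing of the product of the two remaining coordinates leaves exactly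
  -- `±1` and `±j`.
  carrier := {q | (q : ℍ[ℝ]).imI = 0 ∧ (q : ℍ[ℝ]).imK = 0 ∧ (q : ℍ[ℝ]).re * (q : ℍ[ℝ]).imJ = 0}
  one_mem' := by simp
  mul_mem' := by
    rintro a b ⟨h1, h2, h3⟩ ⟨h4, h5, h6⟩
    simp only [Set.mem_ofPred_eq, Submonoid.coe_mul, imI_mul, imK_mul, re_mul, imJ_mul, h1, h2, h4,
      h5]
    refine ⟨by ring, by ring, ?_⟩
    linear_combination ((b : ℍ[ℝ]).re ^ 2 - (b : ℍ[ℝ]).imJ ^ 2) * h3 +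
      ((a : ℍ[ℝ]).re ^ 2 - (a : ℍ[ℝ]).imJ ^ 2) * h6
  inv_mem' := by
    rintro a ⟨h1, h2, h3⟩
    simp [h1, h2, ← Unitary.star_eq_inv]
    simpa using h3

/-- The real part of an element of `{±1, ±j}`. -/
def quarterRe (c : quarterGroup) : ℝ := ((c : UnitQuat) : ℍ[ℝ]).re

/-- The `j`-part of an element of `{±1, ±j}`. -/
def quarterIm (c : quarterGroup) : ℝ := ((c : UnitQuat) : ℍ[ℝ]).imJ

theorem quarterGroup.ext_iff' {c d : quarterGroup} :
    c = d ↔ quarterRe c = quarterRe d ∧ quarterIm c = quarterIm d := by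
  constructor
  · rintro rfl; exact ⟨rfl, rfl⟩
  · rintro ⟨h1, h2⟩
    apply Subtype.ext
    apply Subtype.ext
    ext
    · exact h1
    · exact c.2.1.trans d.2.1.symm
    · exact h2
    · exact c.2.2.1.trans d.2.2.1.symm

theorem quarterRe_mul (c d : quarterGroup) :
    quarterRe (c * d) = quarterRe c * quarterRe d - quarterIm c * quarterIm d := by
  have h1 := c.2.1
  have h2 := c.2.2.1
  simp [quarterRe, quarterIm, h1, h2]

theorem quarterIm_mul (c d : quarterGroup) :
    quarterIm (c * d) = quarterRe c * quarterIm d + quarterIm c * quarterRe d := by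
  have h1 := c.2.1
  have h2 := c.2.2.1
  simp [quarterRe, quarterIm, h1, h2]

@[simp] theorem quarterRe_one : quarterRe 1 = 1 := by simp [quarterRe]

@[simp] theorem quarterIm_one : quarterIm 1 = 0 := by simp [quarterIm]

@[simp] theorem quarterRe_inv (c : quarterGroup) : quarterRe c⁻¹ = quarterRe c := by
  simp [quarterRe, ← Unitary.star_eq_inv]

@[simp] theorem quarterIm_inv (c : quarterGroup) : quarterIm c⁻¹ = -quarterIm c := by
  simp [quarterIm, ← Unitary.star_eq_inv]

theorem quarter_sq (c : quarterGroup) : quarterRe c ^ 2 + quarterIm c ^ 2 = 1 := by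
  have h1 := c.2.1
  have h2 := c.2.2.1
  have := UnitQuat.sq_sum c
  rw [h1, h2] at this
  simpa [quarterRe, quarterIm] using this

theorem quarter_cases (c : quarterGroup) :
    (quarterIm c = 0 ∧ (quarterRe c = 1 ∨ quarterRe c = -1)) ∨
      (quarterRe c = 0 ∧ (quarterIm c = 1 ∨ quarterIm c = -1)) := by
  have h := quarter_sq c
  rcases mul_eq_zero.1 c.2.2.2 with h0 | h0
  · right
    change quarterRe c = 0 at h0
    refine ⟨h0, ?_⟩
    rw [h0] at h
    exact sq_eq_sq_iff_eq_or_eq_neg.1 (by linarith)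
  · left
    change quarterIm c = 0 at h0
    refine ⟨h0, ?_⟩
    rw [h0] at h
    exact sq_eq_sq_iff_eq_or_eq_neg.1 (by linarith)

/-- The element `j` of `{±1, ±j}`. -/
def quarterJ : quarterGroup := ⟨quatJ, rfl, rfl, by simp [quatJ]⟩

@[simp] theorem quarterRe_J : quarterRe quarterJ = 0 := rfl

@[simp] theorem quarterIm_J : quarterIm quarterJ = 1 := rfl

/-- The inclusion of `μ_2` into `{±1, ±j}`. -/
def signQuarter : Mu2 →* quarterGroup :=
  signHom.codRestrict quarterGroup fun e => ⟨rfl, rfl, by simp [signHom]⟩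

@[simp] theorem quarterRe_sign (e : Mu2) : quarterRe (signQuarter e) = ((e : ℝˣ) : ℝ) := rfl

@[simp] theorem quarterIm_sign (e : Mu2) : quarterIm (signQuarter e) = 0 := rfl

open Classical in
/-- The homomorphism of `{±1, ±j}` onto `Gal(ℂ/ℝ)` with kernel `{±1}`. -/
def quarterToGal : quarterGroup →* GalCR where
  toFun c := if quarterIm c = 0 then 1 else Complex.conjAe
  map_one' := by simp
  map_mul' c d := by
    rw [quarterIm_mul]
    rcases quarter_cases c with ⟨h1, h2 | h2⟩ | ⟨h1, h2 | h2⟩ <;>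
    rcases quarter_cases d with ⟨h3, h4 | h4⟩ | ⟨h3, h4 | h4⟩ <;>
      simp [h1, h2, h3, h4, conjAe_mul_self]

theorem quarterToGal_eq_one_iff {c : quarterGroup} : quarterToGal c = 1 ↔ quarterIm c = 0 := by
  by_cases h : quarterIm c = 0 <;> simp [quarterToGal, h, conjAe_ne_one]

theorem range_signQuarter : signQuarter.range = quarterToGal.ker := by
  ext c
  rw [MonoidHom.mem_ker, quarterToGal_eq_one_iff]
  constructor
  · rintro ⟨e, rfl⟩; rfl
  · intro h
    have h1 := quarter_sq c
    rw [h] at h1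
    have h2 : quarterRe c ≠ 0 := by
      rintro h0
      rw [h0] at h1
      norm_num at h1
    refine ⟨⟨Units.mk0 _ h2, ?_⟩, quarterGroup.ext_iff'.2 ⟨rfl, h.symm⟩⟩
    rw [mem_rootsOfUnity']
    simpa using h1

theorem quarterToGal_J : quarterToGal quarterJ = Complex.conjAe := by
  simp [quarterToGal]

theorem quarterToGal_surjective : Function.Surjective quarterToGal := by
  intro s
  rcases galCR_eq s with rfl | rfl
  · exact ⟨1, map_one _⟩
  · exact ⟨_, quarterToGal_J⟩

theorem quarter_eq (c : quarterGroup) : ∃ e, c = signQuarter e ∨ c = signQuarter e * quarterJ := by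
  by_cases h : quarterToGal c = 1
  · have : c ∈ signQuarter.range := by rw [range_signQuarter]; exact h
    obtain ⟨e, rfl⟩ := this
    exact ⟨e, Or.inl rfl⟩
  · have h1 : quarterToGal c = Complex.conjAe := (galCR_eq _).resolve_left h
    have : c * quarterJ⁻¹ ∈ signQuarter.range := by
      rw [range_signQuarter, MonoidHom.mem_ker, map_mul, map_inv, h1, quarterToGal_J,
        mul_inv_cancel]
    obtain ⟨e, he⟩ := this
    exact ⟨e, Or.inr (by rw [he, inv_mul_cancel_right])⟩

/-- Modulo signs, which die on both sides, only `c = 1` and `c = j` need checking. This square links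
the symplectic and the quaternionic projections. -/
theorem galToSO3_quarterToGal (c : quarterGroup) :
    galToSO3 (quarterToGal c) = spin (c : UnitQuat) := by
  obtain ⟨e, he⟩ := quarter_eq c
  have h1 : spin ((signQuarter e : quarterGroup) : UnitQuat) = 1 := by
    have : signHom e ∈ spin.ker := range_signHom ▸ ⟨e, rfl⟩
    exact this
  have h2 : quarterToGal (signQuarter e) = 1 := quarterToGal_eq_one_iff.2 rfl
  rcases he with rfl | rfl
  · rw [h1, h2, map_one]
  · rw [map_mul, h2, one_mul, quarterToGal_J, galToSO3_conjAe]
    exact ((map_mul spin _ _).trans (by rw [h1, one_mul]; rfl)).symm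

/-- If `q` and some `c` in the group have the same image, they differ by a sign, which the group
contains. This identifies the preimage of the symplectic Weyl group factor by factor. -/
theorem mem_quarterGroup_iff (q : UnitQuat) : q ∈ quarterGroup ↔ spin q ∈ galToSO3.range := by
  constructor
  · exact fun h => ⟨quarterToGal ⟨q, h⟩, galToSO3_quarterToGal ⟨q, h⟩⟩
  · rintro ⟨s, hs⟩
    obtain ⟨c, rfl⟩ := quarterToGal_surjective s
    rw [galToSO3_quarterToGal] at hs
    have h1 : q * (c : UnitQuat)⁻¹ ∈ signHom.range := by
      rw [range_signHom, MonoidHom.mem_ker, map_mul, map_inv, hs, mul_inv_cancel]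
    obtain ⟨e, he⟩ := h1
    have h2 : q = ((signQuarter e * c : quarterGroup) : UnitQuat) := by
      exact mul_inv_eq_iff_eq_mul.1 he.symm
    rw [h2]
    exact SetLike.coe_mem _

/-- The representation of `{±1, ±j}` by `2 × 2` matrices, with `j` acting as a rotation. -/
def quarterMatrix : quarterGroup →* (Matrix (Fin 2) (Fin 2) ℂ)ˣ :=
  MonoidHom.toHomUnits
    { toFun := fun c => !![(quarterRe c : ℂ), -quarterIm c; quarterIm c, quarterRe c]
      map_one' := by
        ext r s
        fin_cases r <;> fin_cases s <;> simp
      map_mul' := fun c d => by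
        ext r s
        fin_cases r <;> fin_cases s <;>
          simp [quarterRe_mul, quarterIm_mul, Matrix.mul_apply] <;> ring }

theorem quarterMatrix_coe (c : quarterGroup) : (quarterMatrix c : Matrix (Fin 2) (Fin 2) ℂ) =
    !![(quarterRe c : ℂ), -quarterIm c; quarterIm c, quarterRe c] := rfl

theorem quarterMatrix_injective : Function.Injective quarterMatrix := by
  intro c d h
  have h1 := congrArg Units.val h
  rw [quarterMatrix_coe, quarterMatrix_coe] at h1
  have h2 := congrFun (congrFun h1 0) 0
  have h3 := congrFun (congrFun h1 1) 0
  simp at h2 h3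
  exact quarterGroup.ext_iff'.2 ⟨h2, h3⟩

/-- This is the symplectic condition for `m = 2`, that is, `SL_2 = Sp_2`: the matrices have
determinant one. -/
theorem quarterMatrix_inv_rev (c : quarterGroup) (s t : Fin 2) :
    (quarterMatrix c⁻¹ : Matrix (Fin 2) (Fin 2) ℂ) t.rev s.rev =
      (-1) ^ (s : ℕ) * (-1) ^ (t : ℕ) * (quarterMatrix c : Matrix (Fin 2) (Fin 2) ℂ) s t := by
  rw [quarterMatrix_coe, quarterMatrix_coe]
  fin_cases s <;> fin_cases t <;> simp

/-! ### Coordinates on the symplectic torus -/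

variable {n : ℕ}

/-- The half, upper or lower, in which a diagonal position lies. -/
def half (n : ℕ) (a : Fin (2 * n)) : Fin 2 := if (a : ℕ) < n then 0 else 1

theorem slot_val (a : Fin (2 * n)) :
    (slot n a : ℕ) = if (a : ℕ) < n then n - 1 - a else a - n := by
  unfold slot
  split_ifs <;> rfl

theorem half_val (a : Fin (2 * n)) : (half n a : ℕ) = if (a : ℕ) < n then 0 else 1 := by
  unfold half
  split_ifs <;> rfl

theorem slot_rev (a : Fin (2 * n)) : slot n a.rev = slot n a := by
  apply Fin.ext
  rw [slot_val, slot_val, Fin.val_rev]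
  have := a.2
  split_ifs <;> omega

theorem half_rev (a : Fin (2 * n)) : half n a.rev = (half n a).rev := by
  apply Fin.ext
  rw [Fin.val_rev, half_val, half_val, Fin.val_rev]
  have := a.2
  split_ifs <;> omega

theorem eq_of_slot_half {a b : Fin (2 * n)} (h1 : slot n a = slot n b) (h2 : half n a = half n b) :
    a = b := by
  have h1 := congrArg Fin.val h1
  have h2 := congrArg Fin.val h2
  apply Fin.ext
  rw [slot_val, slot_val] at h1
  rw [half_val, half_val] at h2
  have := a.2
  have := b.2
  split_ifs at h1 h2 <;> omega

/-- A diagonal position is given by its coordinate and its half. -/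
def posEquiv (n : ℕ) : Fin (2 * n) ≃ Fin n × Fin 2 where
  toFun a := (slot n a, half n a)
  invFun p := if p.2 = 0 then ⟨n - 1 - p.1, by omega⟩ else ⟨n + p.1, by omega⟩
  left_inv a := by
    apply Fin.ext
    have := a.2
    by_cases h : (a : ℕ) < n
    · simp [half, slot, h]; omega
    · simp [half, slot, h]; omega
  right_inv p := by
    obtain ⟨i, s⟩ := p
    have := i.2
    fin_cases s
    · have h : n - 1 - (i : ℕ) < n := by omega
      simp [half, slot, h, Fin.ext_iff]
      omega
    · simp [half, slot]

theorem posEquiv_apply (a : Fin (2 * n)) : posEquiv n a = (slot n a, half n a) := rfl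

theorem slot_posEquiv_symm (p : Fin n × Fin 2) : slot n ((posEquiv n).symm p) = p.1 :=
  congrArg Prod.fst ((posEquiv n).apply_symm_apply p)

theorem half_posEquiv_symm (p : Fin n × Fin 2) : half n ((posEquiv n).symm p) = p.2 :=
  congrArg Prod.snd ((posEquiv n).apply_symm_apply p)

/-- The element of the Galois group that is nontrivial exactly for the lower half. -/
def halfGal (s : Fin 2) : GalCR := if s = 0 then 1 else Complex.conjAe

theorem halfGal_injective : Function.Injective halfGal := by
  intro s t h
  have h1 := conjAe_ne_one
  fin_cases s <;> fin_cases t <;> simp_all [halfGal, eq_comm]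

theorem halfGal_rev (s : Fin 2) : halfGal s.rev = Complex.conjAe * halfGal s := by
  fin_cases s <;> simp [halfGal, conjAe_mul_self]

theorem signAct_one (z : ℂˣ) : signAct 1 z = z := if_pos rfl

theorem signAct_conjAe (z : ℂˣ) : signAct Complex.conjAe z = z⁻¹ := if_neg conjAe_ne_one

theorem signAct_conjAe_mul (s : GalCR) (z : ℂˣ) :
    signAct (Complex.conjAe * s) z = (signAct s z)⁻¹ := by
  rcases galCR_eq s with rfl | rfl
  · rw [mul_one, signAct_conjAe, signAct_one]
  · rw [conjAe_mul_self, signAct_conjAe, signAct_one, inv_inv]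

/-- The diagonal entries of `torusElt`. -/
def torusCoord (n : ℕ) (z : Fin n → ℂˣ) (a : Fin (2 * n)) : ℂˣ :=
  signAct (halfGal (half n a)) (z (slot n a))

theorem torusElt_eq (z : Fin n → ℂˣ) : torusElt n z = diagHom (2 * n) ℂ (torusCoord n z) := by
  rw [torusElt]
  congr 1
  ext1 a
  by_cases h : (a : ℕ) < n <;>
    simp [torusCoord, half, halfGal, h, signAct_one, signAct_conjAe]

theorem torusCoord_rev (z : Fin n → ℂˣ) (a : Fin (2 * n)) :
    torusCoord n z a.rev = (torusCoord n z a)⁻¹ := by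
  rw [torusCoord, torusCoord, half_rev, slot_rev, halfGal_rev, signAct_conjAe_mul]

theorem torusCoord_symm_zero (z : Fin n → ℂˣ) (i : Fin n) :
    torusCoord n z ((posEquiv n).symm (i, 0)) = z i := by
  rw [torusCoord, half_posEquiv_symm, slot_posEquiv_symm]
  exact signAct_one _

theorem torusElt_injective : Function.Injective (torusElt n) := by
  intro z w h
  rw [torusElt_eq, torusElt_eq] at h
  ext1 i
  have := congrFun (diagHom_injective h) ((posEquiv n).symm (i, 0))
  rwa [torusCoord_symm_zero, torusCoord_symm_zero] at this

/-- The coordinates `2, 3, 4, …` of a regular element of the torus. -/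
def regCoord (n : ℕ) (i : Fin n) : ℂˣ :=
  Units.mk0 (((i : ℕ) + 2 : ℕ) : ℂ) (Nat.cast_ne_zero.2 (by omega))

/-- Starting the coordinates at `2` rather than `1` keeps them disjoint from their inverses. -/
theorem regCoord_mul_ne_one (i j : Fin n) : regCoord n i * regCoord n j ≠ 1 := by
  intro h
  have h1 : (((i : ℕ) + 2 : ℕ) : ℂ) * (((j : ℕ) + 2 : ℕ) : ℂ) = 1 := congrArg Units.val h
  have h2 : ((i : ℕ) + 2) * ((j : ℕ) + 2) = 1 := by exact_mod_cast h1
  have h3 := Nat.eq_one_of_mul_eq_one_right h2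
  omega

/-- Regularity: the coordinates and their inverses are `2n` distinct numbers, so a signed
permutation is determined by its effect on this one element. -/
theorem signAct_regCoord_inj {s t : GalCR} {i j : Fin n}
    (h : signAct s (regCoord n i) = signAct t (regCoord n j)) : s = t ∧ i = j := by
  have hinj : regCoord n i = regCoord n j → i = j := fun h => by
    have h1 : (i : ℕ) + 2 = (j : ℕ) + 2 := Nat.cast_injective (R := ℂ) (congrArg Units.val h)
    exact Fin.ext (by omega)
  rcases galCR_eq s with rfl | rfl <;> rcases galCR_eq t with rfl | rfl <;>
    simp only [signAct_one, signAct_conjAe] at h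
  · exact ⟨rfl, hinj h⟩
  · exact absurd (by rw [h, inv_mul_cancel]) (regCoord_mul_ne_one i j)
  · exact absurd (by rw [← h, mul_inv_cancel]) (regCoord_mul_ne_one i j)
  · exact ⟨rfl, hinj (inv_injective h)⟩

theorem torusCoord_reg_injective : Function.Injective (torusCoord n (regCoord n)) := by
  intro a b h
  obtain ⟨h1, h2⟩ := signAct_regCoord_inj h
  exact eq_of_slot_half h2 (halfGal_injective h1)

/-! ### The torus of the symplectic group -/

theorem diagHom_inv_coe {m : ℕ} (d : Fin m → ℂˣ) :
    (((diagHom m ℂ d)⁻¹ : GL (Fin m) ℂ) : Matrix (Fin m) (Fin m) ℂ) =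
      diagonal fun i => (((d i)⁻¹ : ℂˣ) : ℂ) := rfl

theorem thetaC_apply {m : ℕ} (g : GL (Fin m) ℂ) (a b : Fin m) :
    (thetaC m g : Matrix (Fin m) (Fin m) ℂ) a b =
      (-1) ^ (a : ℕ) * (-1) ^ (b : ℕ) *
        ((g⁻¹ : GL (Fin m) ℂ) : Matrix (Fin m) (Fin m) ℂ) b.rev a.rev := by
  change (diagonal (fun i : Fin m => (((-1) ^ (i : ℕ) : ℂˣ) : ℂ)) *
    antiTranspose ((g⁻¹ : GL (Fin m) ℂ) : Matrix (Fin m) (Fin m) ℂ) *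
    diagonal (fun i : Fin m => ((((-1) ^ (i : ℕ))⁻¹ : ℂˣ) : ℂ))) a b = _
  rw [Matrix.mul_diagonal, Matrix.diagonal_mul]
  simp [antiTranspose, ← inv_pow, inv_neg]
  ring

theorem mem_Sp_iff {g : GL (Fin (2 * n)) ℂ} : g ∈ Sp n ↔ thetaC (2 * n) g = g := Iff.rfl

theorem diagHom_mem_Sp_iff {d : Fin (2 * n) → ℂˣ} :
    diagHom (2 * n) ℂ d ∈ Sp n ↔ ∀ a, d a.rev = (d a)⁻¹ := by
  have h : thetaC (2 * n) (diagHom (2 * n) ℂ d) = diagHom (2 * n) ℂ fun a => (d a.rev)⁻¹ := by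
    ext a b
    rw [thetaC_apply, diagHom_inv_coe, diagHom_coe]
    by_cases hab : a = b
    · subst hab
      rw [diagonal_apply_eq, diagonal_apply_eq, ← mul_pow]
      simp
    · rw [diagonal_apply_ne _ hab, diagonal_apply_ne _ (fun h : b.rev = a.rev => hab (Fin.rev_injective h).symm),
        mul_zero]
  rw [mem_Sp_iff, h, diagHom_injective.eq_iff, funext_iff]
  exact forall_congr' fun a => inv_eq_iff_eq_inv

theorem torusElt_mem_Sp (z : Fin n → ℂˣ) : torusElt n z ∈ Sp n := by
  rw [torusElt_eq, diagHom_mem_Sp_iff]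
  exact torusCoord_rev z

theorem mem_spTorus_iff {g : Sp n} :
    g ∈ spTorus n ↔ ∃ z, torusElt n z = (g : GL (Fin (2 * n)) ℂ) := by
  constructor
  · intro h
    obtain ⟨d, hd⟩ := Subgroup.mem_subgroupOf.1 h
    refine ⟨fun i => d ((posEquiv n).symm (i, 0)), ?_⟩
    have h1 : diagHom (2 * n) ℂ d ∈ Sp n := hd ▸ g.2
    rw [diagHom_mem_Sp_iff] at h1
    rw [torusElt_eq, ← hd]
    congr 1
    ext1 a
    have h2 : (posEquiv n).symm (slot n a, half n a) = a := (posEquiv n).symm_apply_apply a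
    by_cases h0 : half n a = 0
    · rw [h0] at h2
      rw [torusCoord, h2, h0]
      exact signAct_one _
    · have h3 : half n a = (0 : Fin 2).rev := by
        revert h0
        generalize half n a = s
        fin_cases s <;> simp
      have h4 : (posEquiv n).symm (slot n a, 0) = a.rev := by
        rw [Equiv.symm_apply_eq, posEquiv_apply, slot_rev, half_rev, h3, Fin.rev_rev]
      rw [torusCoord, h4, h1, h3]
      exact (signAct_conjAe _).trans (inv_inv _)
  · rintro ⟨z, hz⟩
    rw [spTorus, Subgroup.mem_subgroupOf, ← hz]
    exact ⟨_, rfl⟩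

end

noncomputable section

/-! ### The lift of the symplectic Weyl group -/

variable {n : ℕ}

/-- The change of signs that turns the symplectic form into an orthogonal sum of `n` copies of the
standard plane, permuted by `𝔖_n`. -/
def twist (n : ℕ) (a : Fin (2 * n)) : ℂˣ := (-1) ^ ((half n a : ℕ) * (slot n a : ℕ))

theorem twist_inv (a : Fin (2 * n)) : (twist n a)⁻¹ = twist n a := by
  rw [twist, ← inv_pow, inv_neg, inv_one]

/-- The group `𝔖_n ⋉ {±1, ±j}^n` as a group of symplectic matrices. -/
def planeHom (n : ℕ) : Wr n quarterGroup →* GL (Fin (2 * n)) ℂ :=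
  (MulAut.conj (diagHom (2 * n) ℂ (twist n))).toMonoidHom.comp
    ((Units.mapEquiv (Matrix.reindexAlgEquiv ℂ ℂ (posEquiv n).symm).toMulEquiv).toMonoidHom.comp
      ((Units.mapEquiv (Matrix.compRingEquiv (Fin n) (Fin 2) ℂ).toMulEquiv).toMonoidHom.comp
        ((monomialHom n (Matrix (Fin 2) (Fin 2) ℂ)).comp (Wr.map n quarterMatrix))))

theorem planeHom_apply (x : Wr n quarterGroup) (a b : Fin (2 * n)) :
    (planeHom n x : Matrix (Fin (2 * n)) (Fin (2 * n)) ℂ) a b =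
      if slot n a = x.right (slot n b) then
        (twist n a : ℂ) * twist n b *
          (quarterMatrix (x.left (slot n a)) : Matrix (Fin 2) (Fin 2) ℂ) (half n a) (half n b)
      else 0 := by
  change (diagonal (fun i => (twist n i : ℂ)) *
    (Matrix.of fun a b => (if slot n a = x.right (slot n b) then
        (quarterMatrix (x.left (slot n a)) : Matrix (Fin 2) (Fin 2) ℂ) else 0)
          (half n a) (half n b)) *
    diagonal (fun i => (((twist n i)⁻¹ : ℂˣ) : ℂ))) a b = _
  rw [Matrix.mul_diagonal, Matrix.diagonal_mul, twist_inv, Matrix.of_apply]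
  split_ifs
  · ring
  · simp

theorem planeHom_injective : Function.Injective (planeHom n) := by
  exact (MulAut.conj (diagHom (2 * n) ℂ (twist n))).injective.comp
    ((Units.mapEquiv _).injective.comp ((Units.mapEquiv _).injective.comp
      (monomialHom_injective.comp (Wr.map_injective quarterMatrix_injective))))

/-- The twist trades the sign `(-1)^a` of `S` for the sign `(-1)^(half n a)` of the standard plane.
The leftover factor `(-1)^(n+1)` does not depend on `a`. -/
theorem neg_one_pow_mul_twist_rev (a : Fin (2 * n)) :
    (-1 : ℂ) ^ (a : ℕ) * twist n a.rev * (-1) ^ (half n a : ℕ) = (-1) ^ (n + 1) * twist n a := by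
  simp only [twist, Units.val_pow_eq_pow_val, Units.val_neg, Units.val_one, ← pow_add]
  apply neg_one_pow_congr
  rw [slot_rev, half_rev, Nat.even_iff, Nat.even_iff, Fin.val_rev, half_val, slot_val]
  have := a.2
  split_ifs <;> simp <;> omega

/-- The twists reduce the symplectic condition to that of a single block, `quarterMatrix_inv_rev`;
row and column each contribute the constant `(-1)^(n+1)`, and the two cancel. -/
theorem planeHom_mem_Sp (x : Wr n quarterGroup) : planeHom n x ∈ Sp n := by
  rw [mem_Sp_iff]
  ext a b
  rw [thetaC_apply, ← map_inv, planeHom_apply, planeHom_apply, slot_rev, slot_rev, half_rev,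
    half_rev, Wr.inv_left]
  have hiff : slot n b = x⁻¹.right (slot n a) ↔ slot n a = x.right (slot n b) := by
    rw [SemidirectProduct.inv_right, Equiv.Perm.eq_inv_iff_eq, eq_comm]
  by_cases h : slot n a = x.right (slot n b)
  · rw [if_pos h, if_pos (hiff.2 h), ← h, quarterMatrix_inv_rev]
    have ha := neg_one_pow_mul_twist_rev a
    have hb := neg_one_pow_mul_twist_rev b
    have hn : ((-1 : ℂ) ^ (n + 1)) * (-1) ^ (n + 1) = 1 := by
      rw [← mul_pow]; simp
    calc _ = ((-1 : ℂ) ^ (a : ℕ) * twist n a.rev * (-1) ^ (half n a : ℕ)) *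
          ((-1 : ℂ) ^ (b : ℕ) * twist n b.rev * (-1) ^ (half n b : ℕ)) *
          (quarterMatrix (x.left (slot n a)) : Matrix (Fin 2) (Fin 2) ℂ) (half n a) (half n b) := by
            ring
      _ = ((-1 : ℂ) ^ (n + 1) * (-1) ^ (n + 1)) * ((twist n a : ℂ) * twist n b *
          (quarterMatrix (x.left (slot n a)) : Matrix (Fin 2) (Fin 2) ℂ) (half n a) (half n b)) := by
            rw [ha, hb]; ring
      _ = _ := by rw [hn, one_mul]
  · rw [if_neg h, if_neg (fun h' => h (hiff.1 h')), mul_zero]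

/-- Within one plane, `±1` commutes with `diag(w, w⁻¹)`, while `±j` is antidiagonal and exchanges
`w` with `w⁻¹`. -/
theorem quarterMatrix_mul_signAct (c : quarterGroup) (s t : Fin 2) (w : ℂˣ) :
    (quarterMatrix c : Matrix (Fin 2) (Fin 2) ℂ) s t * (signAct (halfGal t) w : ℂ) =
      (signAct (halfGal s) (signAct (quarterToGal c) w) : ℂ) *
        (quarterMatrix c : Matrix (Fin 2) (Fin 2) ℂ) s t := by
  rw [quarterMatrix_coe]
  by_cases h : quarterToGal c = 1
  · have h1 := quarterToGal_eq_one_iff.1 h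
    fin_cases s <;> fin_cases t <;> simp [h, h1, halfGal, signAct_one, signAct_conjAe, mul_comm]
  · have h2 : quarterRe c = 0 := by
      have := (mul_eq_zero.1 c.2.2.2).resolve_right fun h0 => h (quarterToGal_eq_one_iff.2 h0)
      exact this
    have h3 := (galCR_eq _).resolve_left h
    fin_cases s <;> fin_cases t <;> simp [h3, h2, halfGal, signAct_one, signAct_conjAe, mul_comm]

/-- The action of the lift of the Weyl group on the torus by signed permutations. -/
theorem planeHom_conj_torusElt (x : Wr n quarterGroup) (z : Fin n → ℂˣ) :
    planeHom n x * torusElt n z * (planeHom n x)⁻¹ =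
      torusElt n fun i => signAct (quarterToGal (x.left i)) (z (x.right⁻¹ i)) := by
  rw [mul_inv_eq_iff_eq_mul, torusElt_eq, torusElt_eq]
  ext a b
  rw [Units.val_mul, Units.val_mul, diagHom_coe, diagHom_coe, Matrix.mul_diagonal,
    Matrix.diagonal_mul, planeHom_apply]
  by_cases h : slot n a = x.right (slot n b)
  · have h1 : slot n b = x.right⁻¹ (slot n a) := by rw [h, Equiv.Perm.coe_inv, Equiv.symm_apply_apply]
    rw [if_pos h, torusCoord, torusCoord, ← h1]
    linear_combination (twist n a : ℂ) * twist n b * quarterMatrix_mul_signAct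
      (x.left (slot n a)) (half n a) (half n b) (z (slot n b))
  · rw [if_neg h, zero_mul, mul_zero]

/-- A sign is its own inverse, so the scalar block `±1` has the shape `diag(z, z⁻¹)`, and the twists
cancel on the diagonal. -/
theorem planeHom_inl_sign (e : Fin n → Mu2) :
    planeHom n (SemidirectProduct.inl (piMap n signQuarter e)) =
      torusElt n fun i => Units.map (algebraMap ℝ ℂ : ℝ →* ℂ) ((e i : Mu2) : ℝˣ) := by
  rw [torusElt_eq]
  ext a b
  rw [planeHom_apply, diagHom_coe, SemidirectProduct.right_inl, SemidirectProduct.left_inl,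
    Equiv.Perm.one_apply, quarterMatrix_coe]
  have hpi : piMap n signQuarter e (slot n a) = signQuarter (e (slot n a)) := rfl
  rw [hpi, quarterRe_sign, quarterIm_sign]
  have he : (((e (slot n a) : ℝˣ) : ℝ) : ℂ)⁻¹ = (((e (slot n a) : ℝˣ) : ℝ) : ℂ) := by
    have := (mem_rootsOfUnity' 2 (e (slot n a) : ℝˣ)).1 (e (slot n a)).2
    rw [← Complex.ofReal_inv]
    congr 1
    exact inv_eq_of_mul_eq_one_left (by rw [← pow_two, this])
  have htw : ∀ a, (twist n a : ℂ) * twist n a = 1 := fun a => by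
    rw [← Units.val_mul]
    nth_rw 1 [← twist_inv]
    simp
  by_cases hab : a = b
  · subst hab
    rw [if_pos rfl, diagonal_apply_eq, htw, torusCoord]
    generalize half n a = s
    fin_cases s
    · simp [halfGal, signAct_one]
    · simp [halfGal, signAct_conjAe, he]
  · rw [diagonal_apply_ne _ hab]
    split_ifs with h
    · have h2 : half n a ≠ half n b := fun h' => hab (eq_of_slot_half h h')
      revert h2
      generalize half n a = s
      generalize half n b = t
      intro h2
      fin_cases s <;> fin_cases t <;> simp at h2 ⊢
    · rfl

theorem mem_spNormalizer_of_conj {g : Sp n}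
    (h1 : ∀ z, ∃ w, (g : GL (Fin (2 * n)) ℂ) * torusElt n z * (g : GL (Fin (2 * n)) ℂ)⁻¹ =
      torusElt n w)
    (h2 : ∀ z, ∃ w, (g : GL (Fin (2 * n)) ℂ)⁻¹ * torusElt n z * (g : GL (Fin (2 * n)) ℂ) =
      torusElt n w) : g ∈ spNormalizer n := by
  rw [Subgroup.mem_normalizer_iff]
  refine fun h => ⟨fun hh => ?_, fun hh => ?_⟩
  · obtain ⟨z, hz⟩ := mem_spTorus_iff.1 hh
    obtain ⟨w, hw⟩ := h1 z
    exact mem_spTorus_iff.2 ⟨w, by rw [← hw, hz]; rfl⟩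
  · obtain ⟨z, hz⟩ := mem_spTorus_iff.1 hh
    obtain ⟨w, hw⟩ := h2 z
    refine mem_spTorus_iff.2 ⟨w, ?_⟩
    rw [← hw, hz]
    simp [mul_assoc]

/-- The group `𝔖_n ⋉ {±1, ±j}^n` as a subgroup of the normalizer of the torus. -/
def planeLift (n : ℕ) : Wr n quarterGroup →* spNormalizer n :=
  ((planeHom n).codRestrict (Sp n) planeHom_mem_Sp).codRestrict (spNormalizer n) fun x =>
    mem_spNormalizer_of_conj (fun z => ⟨_, planeHom_conj_torusElt x z⟩) fun z => by
      have := planeHom_conj_torusElt x⁻¹ z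
      rw [map_inv, inv_inv] at this
      exact ⟨_, this⟩

theorem planeLift_coe (x : Wr n quarterGroup) :
    (((planeLift n x : spNormalizer n) : Sp n) : GL (Fin (2 * n)) ℂ) = planeHom n x := rfl

theorem planeLift_injective : Function.Injective (planeLift n) := by
  intro x y h
  apply planeHom_injective
  rw [← planeLift_coe, h, planeLift_coe]

/-- The normalizer of the torus acts on the torus. -/
theorem exists_conj_torusElt (g : spNormalizer n) (z : Fin n → ℂˣ) :
    ∃ w, torusElt n w = ((g : Sp n) : GL (Fin (2 * n)) ℂ) * torusElt n z *
      ((g : Sp n) : GL (Fin (2 * n)) ℂ)⁻¹ :=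
  mem_spTorus_iff.1 ((Subgroup.mem_normalizer_iff.1 g.2 ⟨torusElt n z, torusElt_mem_Sp z⟩).1
    (mem_spTorus_iff.2 ⟨z, rfl⟩))

theorem exists_monomialHom_eq_of_conj_reg (g : GL (Fin (2 * n)) ℂ) (w : Fin n → ℂˣ)
    (h : torusElt n w = g * torusElt n (regCoord n) * g⁻¹) :
    ∃ x, monomialHom (2 * n) ℂ x = g ∧
      ∀ a, torusCoord n w a = torusCoord n (regCoord n) (x.right⁻¹ a) := by
  have h' := h
  rw [eq_mul_inv_iff_mul_eq, torusElt_eq, torusElt_eq] at h'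
  obtain ⟨x, rfl⟩ := exists_monomialHom_eq g (fun a => torusCoord n (regCoord n) a)
    (fun a => torusCoord n w a) (Units.val_injective.comp torusCoord_reg_injective)
    (fun _ _ => Commute.all _ _) (congrArg Units.val h').symm
  refine ⟨x, rfl, fun a => ?_⟩
  rw [torusElt_eq, torusElt_eq, monomialHom_conj_diagHom] at h
  rw [congrFun (diagHom_injective h) a, mul_inv_cancel_comm]

/-- The centralizer of a matrix with distinct eigenvalues is diagonal; here the permutation part of
a monomial matrix must fix all the entries. -/
theorem mem_diagSubgroup_of_commute_reg (g : GL (Fin (2 * n)) ℂ)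
    (h : torusElt n (regCoord n) = g * torusElt n (regCoord n) * g⁻¹) :
    g ∈ diagSubgroup (2 * n) ℂ := by
  obtain ⟨x, rfl, hx⟩ := exists_monomialHom_eq_of_conj_reg g _ h
  have hr : x.right⁻¹ = 1 := Equiv.ext fun a => (torusCoord_reg_injective (hx a)).symm
  refine ⟨x.left, ?_⟩
  rw [← monomialHom_inl]
  congr 1
  exact Wr.ext_iff'.2 ⟨fun _ => rfl, (inv_eq_one.1 hr).symm⟩

theorem eq_or_eq_rev_of_slot_eq {a b : Fin (2 * n)} (h : slot n a = slot n b) :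
    a = b ∨ a = b.rev := by
  by_cases h1 : half n a = half n b
  · exact Or.inl (eq_of_slot_half h h1)
  · right
    refine eq_of_slot_half (h.trans (slot_rev b).symm) ?_
    rw [half_rev]
    revert h1
    generalize half n a = s
    generalize half n b = t
    intro h1
    fin_cases s <;> fin_cases t <;> simp at h1 ⊢

/-- Every element of the normalizer of the torus acts on a regular element of the torus by a signed
permutation. -/
theorem exists_signedPerm (g : spNormalizer n) : ∃ y : Wr n quarterGroup,
    ((g : Sp n) : GL (Fin (2 * n)) ℂ) * torusElt n (regCoord n) *
      ((g : Sp n) : GL (Fin (2 * n)) ℂ)⁻¹ =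
    planeHom n y * torusElt n (regCoord n) * (planeHom n y)⁻¹ := by
  obtain ⟨w, hw⟩ := exists_conj_torusElt g (regCoord n)
  obtain ⟨x, -, hx⟩ := exists_monomialHom_eq_of_conj_reg _ w hw
  -- Reversal of positions inverts torus entries, so the permutation respects the pairs `{a,
  -- a.rev}`.
  have hrev : ∀ a, x.right⁻¹ a.rev = (x.right⁻¹ a).rev := fun a => by
    apply torusCoord_reg_injective
    rw [← hx, torusCoord_rev, torusCoord_rev, ← hx]
  -- `p i` is the position whose entry becomes the `i`-th coordinate: its slot gives the
  -- permutation, its half the sign.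
  let p : Fin n → Fin (2 * n) := fun i => x.right⁻¹ ((posEquiv n).symm (i, 0))
  have hinj : Function.Injective fun i => slot n (p i) := by
    intro i j hij
    have h1 : (posEquiv n).symm (i, 0) = (posEquiv n).symm (j, 0) ∨
        (posEquiv n).symm (i, 0) = ((posEquiv n).symm (j, 0)).rev := by
      rcases eq_or_eq_rev_of_slot_eq hij with h | h
      · exact Or.inl (x.right⁻¹.injective h)
      · exact Or.inr (x.right⁻¹.injective (h.trans (hrev _).symm))
    rcases h1 with h | h
    · simpa [slot_posEquiv_symm] using congrArg (slot n) h
    · simpa [slot_rev, slot_posEquiv_symm] using congrArg (slot n) h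
  let σ : Equiv.Perm (Fin n) := Equiv.ofBijective _ (Finite.injective_iff_bijective.1 hinj)
  choose c hc using fun i => quarterToGal_surjective (halfGal (half n (p i)))
  -- `σ` sends a coordinate to its source, whereas the wreath product acts through the inverse of
  -- its permutation.
  refine ⟨⟨c, σ⁻¹⟩, ?_⟩
  rw [← hw, planeHom_conj_torusElt]
  congr 1
  ext1 i
  rw [← torusCoord_symm_zero w i, hx, hc, inv_inv]
  rfl

/-- The map from `𝔖_n ⋉ {±1, ±j}^n` onto the symplectic Weyl group. -/
def planeToWeyl (n : ℕ) : Wr n quarterGroup →* SpWeyl n :=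
  (QuotientGroup.mk' _).comp (planeLift n)

/-- A normalizer element and the signed permutation it induces agree on the regular element, so
their quotient centralizes it and lies in the torus. -/
theorem planeToWeyl_surjective : Function.Surjective (planeToWeyl n) := by
  intro w
  obtain ⟨g, rfl⟩ := QuotientGroup.mk_surjective w
  obtain ⟨y, hy⟩ := exists_signedPerm g
  refine ⟨y, QuotientGroup.eq.2 ?_⟩
  rw [Subgroup.mem_subgroupOf, spTorus, Subgroup.mem_subgroupOf]
  apply mem_diagSubgroup_of_commute_reg
  change _ = ((planeHom n y)⁻¹ * ((g : Sp n) : GL (Fin (2 * n)) ℂ)) * torusElt n (regCoord n) *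
    ((planeHom n y)⁻¹ * ((g : Sp n) : GL (Fin (2 * n)) ℂ))⁻¹
  calc _ = (planeHom n y)⁻¹ * (planeHom n y * torusElt n (regCoord n) * (planeHom n y)⁻¹) *
        planeHom n y := by group
    _ = _ := by rw [← hy]; group

/-- A torus element fixes the regular element, hence induces the trivial signed permutation.
Conversely, the kernel consists of sign vectors, which are torus elements by `planeHom_inl_sign`. -/
theorem planeLift_mem_torus_iff (x : Wr n quarterGroup) :
    planeLift n x ∈ (spTorus n).subgroupOf (spNormalizer n) ↔
      x ∈ (Wr.map n quarterToGal).ker := by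
  rw [Subgroup.mem_subgroupOf, mem_spTorus_iff]
  constructor
  · rintro ⟨w, hw⟩
    have h := planeHom_conj_torusElt x (regCoord n)
    have h1 : planeHom n x = torusElt n w := hw.symm
    rw [h1, torusElt_eq, torusElt_eq, ← map_mul, ← map_inv, ← map_mul, mul_inv_cancel_comm,
      ← torusElt_eq] at h
    have h2 : ∀ i, signAct 1 (regCoord n i) = _ := fun i =>
      (signAct_one _).trans (congrFun (torusElt_injective h) i)
    rw [MonoidHom.mem_ker, Wr.map_eq_one_iff]
    refine ⟨fun i => (signAct_regCoord_inj (h2 i)).1.symm, ?_⟩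
    rw [← inv_eq_one]
    exact Equiv.ext fun i => (signAct_regCoord_inj (h2 i)).2.symm
  · intro hx
    rw [← Wr.range_inl_comp_piMap range_signQuarter] at hx
    obtain ⟨e, rfl⟩ := hx
    exact ⟨_, (planeHom_inl_sign e).symm⟩

theorem ker_planeToWeyl : (planeToWeyl n).ker = (Wr.map n quarterToGal).ker := by
  ext x
  rw [← planeLift_mem_torus_iff, MonoidHom.mem_ker]
  exact QuotientGroup.eq_one_iff _

/-- The symplectic Weyl group is `𝔖_n ⋉ Gal(ℂ/ℝ)^n`. -/
def spWeylEquiv (n : ℕ) : SpWeyl n ≃* Wr n GalCR :=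
  (QuotientGroup.quotientKerEquivOfSurjective _ planeToWeyl_surjective).symm.trans
    ((QuotientGroup.quotientMulEquivOfEq ker_planeToWeyl).trans
      (QuotientGroup.quotientKerEquivOfSurjective _
        (Wr.map_surjective quarterToGal_surjective)))

theorem spWeylEquiv_planeToWeyl (x : Wr n quarterGroup) :
    spWeylEquiv n (planeToWeyl n x) = Wr.map n quarterToGal x := by
  have h : (QuotientGroup.quotientKerEquivOfSurjective (planeToWeyl n)
      planeToWeyl_surjective).symm (planeToWeyl n x) = QuotientGroup.mk x := by
    rw [MulEquiv.symm_apply_eq]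
    rfl
  rw [spWeylEquiv, MulEquiv.trans_apply, h]
  rfl

/-- The element `g` differs from a lift in `planeLift` by a torus element, which acts trivially
because the torus is commutative. -/
theorem conj_torusElt_eq_signAct (g : spNormalizer n) (z : Fin n → ℂˣ) :
    ((g : Sp n) : GL (Fin (2 * n)) ℂ) * torusElt n z * ((g : Sp n) : GL (Fin (2 * n)) ℂ)⁻¹ =
      torusElt n fun i => signAct ((spWeylEquiv n (QuotientGroup.mk g)).left i)
        (z ((spWeylEquiv n (QuotientGroup.mk g)).right⁻¹ i)) := by
  obtain ⟨x, hx⟩ := planeToWeyl_surjective (QuotientGroup.mk g)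
  rw [← hx, spWeylEquiv_planeToWeyl]
  refine Eq.trans ?_ (planeHom_conj_torusElt x z)
  have h1 : (planeLift n x)⁻¹ * g ∈ (spTorus n).subgroupOf (spNormalizer n) := QuotientGroup.eq.1 hx
  rw [Subgroup.mem_subgroupOf, mem_spTorus_iff] at h1
  obtain ⟨w, hw⟩ := h1
  have h2 : ((g : Sp n) : GL (Fin (2 * n)) ℂ) = planeHom n x * torusElt n w := by
    rw [hw, ← planeLift_coe]
    simp
  have h3 : torusElt n w * torusElt n z = torusElt n z * torusElt n w := by
    rw [torusElt_eq, torusElt_eq, ← map_mul, ← map_mul, mul_comm (torusCoord n w)]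
  rw [h2, _root_.mul_inv_rev, mul_assoc (planeHom n x), h3]
  group

end

noncomputable section

/-! ### The exponential of a quarter turn -/

/-- The algebra homomorphism from `ℂ^3` that sends `(0, i, -i)` to `X`, where `X ^ 3 = -X`. -/
def turnHom {R : Type*} [Ring R] [Algebra ℂ R] (X : R) (h : X * X * X = -X) :
    (Fin 3 → ℂ) →+* R where
  -- Lagrange interpolation: the quadratic polynomial with values `v 0, v 1, v 2` at `0, i, -i`, the
  -- roots of `t³ + t`, evaluated at `X`.
  toFun v := v 0 • (1 : R) + (v 0 - v 1 / 2 - v 2 / 2) • (X * X) +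
    (Complex.I / 2 * (v 2 - v 1)) • X
  map_zero' := by simp
  map_one' := by simp; left; ring
  map_add' v w := by
    simp only [Pi.add_apply]
    module
  map_mul' v w := by
    have h1 : X * (X * X) = -X := by rw [← mul_assoc, h]
    have h2 : X * X * (X * X) = -(X * X) := by rw [← mul_assoc, h, neg_mul]
    simp only [add_mul, mul_add, smul_mul_smul_comm, one_mul, mul_one, h, h1, h2, Pi.mul_apply]
    match_scalars
    · ring
    · linear_combination (-(v 2 - v 1) * (w 2 - w 1) / 4) * Complex.I_sq
    · ring

/-- Through `turnHom` the exponential is computed at the three roots, with values `1, i, -i`, which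
are interpolated by `1 + t + t²`. Continuity carries the exponential across the homomorphism. -/
theorem exp_quarter_turn {R : Type*} [NormedRing R] [NormedAlgebra ℂ R] [NormedAlgebra ℚ R]
    (X : R) (h : X * X * X = -X) :
    NormedSpace.exp ((Real.pi / 2 : ℂ) • X) = 1 + X + X * X := by
  have hc : Continuous (turnHom X h) := by
    change Continuous fun v : Fin 3 → ℂ => v 0 • (1 : R) +
      (v 0 - v 1 / 2 - v 2 / 2) • (X * X) + (Complex.I / 2 * (v 2 - v 1)) • X
    fun_prop
  have h1 : turnHom X h ![0, Real.pi / 2 * Complex.I, -(Real.pi / 2 * Complex.I)] =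
      (Real.pi / 2 : ℂ) • X := by
    simp only [turnHom, RingHom.coe_mk, MonoidHom.coe_mk, OneHom.coe_mk, Matrix.cons_val]
    match_scalars
    · ring
    · ring
    · linear_combination (-(Real.pi / 2 : ℂ)) * Complex.I_sq
  have h2 : NormedSpace.exp (![0, Real.pi / 2 * Complex.I, -(Real.pi / 2 * Complex.I)] :
      Fin 3 → ℂ) = ![1, Complex.I, -Complex.I] := by
    ext i
    rw [Pi.coe_exp, ← Complex.exp_eq_exp_ℂ]
    fin_cases i
    · simp
    · simp [Complex.exp_pi_div_two_mul_I]
    · simp [Complex.exp_neg, Complex.exp_pi_div_two_mul_I]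
  rw [← h1, ← NormedSpace.map_exp _ hc, h2]
  simp only [turnHom, RingHom.coe_mk, MonoidHom.coe_mk, OneHom.coe_mk, Matrix.cons_val]
  match_scalars
  · ring
  · ring
  · linear_combination (-1 : ℂ) * Complex.I_sq

theorem matrix_exp_quarter_turn {m : ℕ} (X : Matrix (Fin m) (Fin m) ℂ) (h : X * X * X = -X) :
    NormedSpace.exp ((Real.pi / 2 : ℂ) • X) = 1 + X + X * X := by
  let _ : NormedRing (Matrix (Fin m) (Fin m) ℂ) := Matrix.linftyOpNormedRing
  let _ : NormedAlgebra ℂ (Matrix (Fin m) (Fin m) ℂ) := Matrix.linftyOpNormedAlgebra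
  let _ : NormedAlgebra ℚ (Matrix (Fin m) (Fin m) ℂ) := Matrix.linftyOpNormedAlgebra
  exact exp_quarter_turn X h

end

noncomputable section

/-! ### The Tits generators -/

variable {n : ℕ}

/-- The positions `a` for which the simple root `i` couples `a` with `a + 1`. -/
abbrev IsBond (n i a : ℕ) : Prop := a + 1 + i = n ∨ a + 1 = n + i

/-- Bonds of the root `i` start at `n-1-i` and `n+i-1`. The difference `2i` is even, so bonds never
share an end; for `i = 0` the two coincide. -/
theorem not_isBond_succ {n i a : ℕ} (h : IsBond n i a) : ¬ IsBond n i (a + 1) := by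
  unfold IsBond at *
  omega

/-- The involution exchanging the ends of the bonds of the simple root `i`. -/
def bondPerm (n : ℕ) (i : Fin n) : Equiv.Perm (Fin (2 * n)) :=
  Function.Involutive.toPerm
    (fun a => if h : IsBond n i a then ⟨a + 1, by unfold IsBond at h; omega⟩
      -- The guard is needed because `a - 1` is truncated: at `a = 0` it would test position `0`
      -- again.
      else if (a : ℕ) ≠ 0 ∧ IsBond n i (a - 1) then ⟨a - 1, by omega⟩ else a)
    (by
      intro a
      apply Fin.ext
      by_cases h : IsBond n i a
      · simp [h, not_isBond_succ h]
      · by_cases h' : (a : ℕ) ≠ 0 ∧ IsBond n i (a - 1)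
        · simp [h, h']
          omega
        · simp [h, h'])

theorem bondPerm_val (i : Fin n) (a : Fin (2 * n)) : (bondPerm n i a : ℕ) =
    if IsBond n i a then (a : ℕ) + 1 else
      if (a : ℕ) ≠ 0 ∧ IsBond n i (a - 1) then (a : ℕ) - 1 else a := by
  change Fin.val (dite _ _ _) = _
  split_ifs <;> rfl

theorem bondPerm_mul_self (i : Fin n) : bondPerm n i * bondPerm n i = 1 :=
  Equiv.ext (Function.Involutive.toPerm_involutive _)

/-- The nonzero entries of `f_i - e_i`. -/
def bondSign (n : ℕ) (i : Fin n) (a : Fin (2 * n)) : ℂ :=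
  if IsBond n i a then -1 else if (a : ℕ) ≠ 0 ∧ IsBond n i (a - 1) then 1 else 0

theorem chevF_sub_chevE (i : Fin n) :
    chevF n i - chevE n i = monomialMatrix (2 * n) ℂ (bondSign n i) (bondPerm n i) := by
  ext a b
  have h1 : (chevF n i - chevE n i) a b =
      (if (b : ℕ) + 1 = a ∧ IsBond n i b then 1 else 0) -
        (if (a : ℕ) + 1 = b ∧ IsBond n i a then 1 else 0) := rfl
  have h2 : monomialMatrix (2 * n) ℂ (bondSign n i) (bondPerm n i) a b =
      if a = bondPerm n i b then bondSign n i a else 0 := rfl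
  rw [h1, h2]
  simp only [Fin.ext_iff, bondPerm_val, bondSign, IsBond]
  have := i.2
  split_ifs <;> first | omega | norm_num

theorem bondSign_bondPerm (i : Fin n) (a : Fin (2 * n)) :
    bondSign n i (bondPerm n i a) = -bondSign n i a := by
  simp only [bondSign, bondPerm_val, IsBond]
  have := i.2
  split_ifs <;> first | omega | norm_num

theorem bondSign_pow_three (i : Fin n) (a : Fin (2 * n)) :
    bondSign n i a * bondSign n i a * bondSign n i a = bondSign n i a := by
  unfold bondSign
  split_ifs <;> norm_num

theorem bondPerm_inv (i : Fin n) : (bondPerm n i)⁻¹ = bondPerm n i :=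
  inv_eq_of_mul_eq_one_left (bondPerm_mul_self i)

/-- With `X = f_i - e_i` a signed partial involution, `X²` is `-1` on the ends of bonds and `0`
elsewhere, so `X³ = -X`. -/
theorem titsGen_eq (i : Fin n) : titsGen n i = 1 +
    monomialMatrix (2 * n) ℂ (bondSign n i) (bondPerm n i) +
    monomialMatrix (2 * n) ℂ (fun a => -(bondSign n i a * bondSign n i a)) 1 := by
  have hsq : monomialMatrix (2 * n) ℂ (bondSign n i) (bondPerm n i) *
      monomialMatrix (2 * n) ℂ (bondSign n i) (bondPerm n i) =
      monomialMatrix (2 * n) ℂ (fun a => -(bondSign n i a * bondSign n i a)) 1 := by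
    rw [monomialMatrix_mul, bondPerm_mul_self]
    congr 1
    ext1 a
    rw [bondPerm_inv, bondSign_bondPerm, mul_neg]
  rw [titsGen, chevF_sub_chevE, matrix_exp_quarter_turn, hsq]
  rw [hsq, monomialMatrix_mul, one_mul]
  ext a b
  simp only [monomialMatrix, Matrix.of_apply, Matrix.neg_apply]
  split_ifs
  · rw [inv_one, Equiv.Perm.one_apply, neg_mul, bondSign_pow_three]
  · rw [neg_zero]

theorem titsGen_apply (i : Fin n) (a b : Fin (2 * n)) : titsGen n i a b =
    if (b : ℕ) + 1 = a ∧ IsBond n i b then 1 else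
      if (a : ℕ) + 1 = b ∧ IsBond n i a then -1 else
        if a = b ∧ ¬ IsBond n i a ∧ ¬ ((a : ℕ) ≠ 0 ∧ IsBond n i (a - 1)) then 1 else 0 := by
  have h1 : (chevF n i - chevE n i) a b =
      (if (b : ℕ) + 1 = a ∧ IsBond n i b then 1 else 0) -
        (if (a : ℕ) + 1 = b ∧ IsBond n i a then 1 else 0) := rfl
  rw [titsGen_eq, ← chevF_sub_chevE, Matrix.add_apply, Matrix.add_apply, h1]
  by_cases hab : a = b
  · subst hab
    simp only [monomialMatrix, Matrix.of_apply, Matrix.one_apply, Equiv.Perm.one_apply, if_true,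
      bondSign, true_and, IsBond]
    split_ifs <;> first | omega | norm_num
  · have hab' : (a : ℕ) ≠ b := fun h => hab (Fin.ext h)
    simp only [monomialMatrix, Matrix.of_apply, Matrix.one_apply, Equiv.Perm.one_apply, hab,
      if_false, false_and, IsBond]
    split_ifs <;> first | omega | norm_num

theorem titsGen_eq_one {i : Fin n} {a b : Fin (2 * n)} (h : (b : ℕ) + 1 = a ∧ IsBond n i b) :
    titsGen n i a b = 1 := by
  rw [titsGen_apply, if_pos h]

theorem titsGen_eq_neg_one {i : Fin n} {a b : Fin (2 * n)}
    (h : (a : ℕ) + 1 = b ∧ IsBond n i a) : titsGen n i a b = -1 := by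
  rw [titsGen_apply, if_neg (by omega), if_pos h]

theorem titsGen_self {i : Fin n} {a : Fin (2 * n)}
    (h : ¬ IsBond n i a ∧ ¬ ((a : ℕ) ≠ 0 ∧ IsBond n i (a - 1))) : titsGen n i a a = 1 := by
  rw [titsGen_apply, if_neg (by omega), if_neg (by omega), if_pos ⟨rfl, h⟩]

theorem titsGen_eq_zero {i : Fin n} {a b : Fin (2 * n)}
    (h1 : ¬ ((b : ℕ) + 1 = a ∧ IsBond n i b)) (h2 : ¬ ((a : ℕ) + 1 = b ∧ IsBond n i a))
    (h3 : (a : ℕ) = b → IsBond n i a ∨ ((a : ℕ) ≠ 0 ∧ IsBond n i (a - 1))) :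
    titsGen n i a b = 0 := by
  rw [titsGen_apply, if_neg h1, if_neg h2, if_neg]
  rintro ⟨rfl, h4, h5⟩
  exact (h3 rfl).elim h4 h5

/-- The lift of the sign change of the first coordinate. -/
def longLift (n : ℕ) (i : Fin n) : Wr n quarterGroup :=
  SemidirectProduct.inl (Pi.mulSingle i quarterJ)

/-- The lift of the exchange of the coordinates `i'` and `i`. -/
def shortLift (n : ℕ) (i' i : Fin n) : Wr n quarterGroup :=
  SemidirectProduct.inl (Pi.mulSingle i (quarterJ * quarterJ)) *
    SemidirectProduct.inr (Equiv.swap i' i)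

theorem quarterMatrix_apply (c : quarterGroup) (s t : Fin 2) :
    (quarterMatrix c : Matrix (Fin 2) (Fin 2) ℂ) s t =
      if s = t then (quarterRe c : ℂ) else if s = 0 then -quarterIm c else quarterIm c := by
  rw [quarterMatrix_coe]
  fin_cases s <;> fin_cases t <;> simp

theorem pos_cases (a : Fin (2 * n)) :
    ((a : ℕ) < n ∧ half n a = 0 ∧ (slot n a : ℕ) = n - 1 - a) ∨
      (n ≤ (a : ℕ) ∧ half n a = 1 ∧ (slot n a : ℕ) = a - n) := by
  rw [slot_val]
  by_cases h : (a : ℕ) < n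
  · exact Or.inl ⟨h, if_pos h, if_pos h⟩
  · exact Or.inr ⟨not_lt.1 h, if_neg h, if_neg h⟩

theorem twist_mul_self (a : Fin (2 * n)) : (twist n a : ℂ) * twist n a = 1 := by
  rw [← Units.val_mul]
  nth_rw 1 [← twist_inv]
  simp

theorem twist_of_half_eq_zero {a : Fin (2 * n)} (h : half n a = 0) : (twist n a : ℂ) = 1 := by
  simp [twist, h]

theorem twist_mul_twist {a b : Fin (2 * n)} (ha : half n a = 1) (hb : half n b = 1)
    (h : (slot n a : ℕ) + 1 = slot n b) : (twist n a : ℂ) * twist n b = -1 := by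
  simp only [twist, ha, hb, ← h, Units.val_pow_eq_pow_val, Units.val_neg, Units.val_one, ← pow_add]
  exact Odd.neg_one_pow ⟨slot n a, by simp; ring⟩

theorem longLift_left {i : Fin n} (j : Fin n) :
    (longLift n i).left j = if j = i then quarterJ else 1 :=
  Pi.mulSingle_apply _ _ _

theorem shortLift_left {i' i : Fin n} (j : Fin n) :
    (shortLift n i' i).left j = if j = i then quarterJ * quarterJ else 1 :=
  (mul_one _).trans (Pi.mulSingle_apply _ _ _)

/-- The only bond of the long root joins positions `n-1` and `n`, the two halves of slot `0`, where
the twist is trivial. The generator is thus the quarter turn of that plane. -/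
theorem planeHom_longLift (i : Fin n) (hi : (i : ℕ) = 0) :
    (planeHom n (longLift n i) : Matrix (Fin (2 * n)) (Fin (2 * n)) ℂ) = titsGen n i := by
  ext a b
  rw [planeHom_apply, quarterMatrix_apply, longLift_left]
  have hr : (longLift n i).right = 1 := rfl
  rw [hr, Equiv.Perm.one_apply]
  by_cases hs : slot n a = slot n b
  · have hs' := congrArg Fin.val hs
    rw [if_pos hs]
    by_cases hi' : slot n a = i
    · have h0 := congrArg Fin.val hi'
      have htw : (twist n a : ℂ) * twist n b = 1 := by
        have h2 : (slot n b : ℕ) = 0 := by omega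
        simp [twist, h0, hi, h2]
      rw [htw, if_pos hi', one_mul, quarterRe_J, quarterIm_J]
      rcases pos_cases a with ⟨h1, h2, h3⟩ | ⟨h1, h2, h3⟩ <;>
      rcases pos_cases b with ⟨h4, h5, h6⟩ | ⟨h4, h5, h6⟩ <;> rw [h2, h5]
      · rw [titsGen_eq_zero (by omega) (by omega) (by omega)]
        simp
      · rw [titsGen_eq_neg_one (by omega)]
        simp
      · rw [titsGen_eq_one (by omega)]
        simp
      · rw [titsGen_eq_zero (by omega) (by omega) (by omega)]
        simp
    · have h0 : (slot n a : ℕ) ≠ i := fun h => hi' (Fin.ext h)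
      rw [if_neg hi', quarterRe_one, quarterIm_one]
      rcases pos_cases a with ⟨h1, h2, h3⟩ | ⟨h1, h2, h3⟩ <;>
      rcases pos_cases b with ⟨h4, h5, h6⟩ | ⟨h4, h5, h6⟩
      · obtain rfl := eq_of_slot_half hs (h2.trans h5.symm)
        rw [titsGen_self (by omega), twist_mul_self]
        simp
      · rw [titsGen_eq_zero (by omega) (by omega) (by omega), h2, h5]
        simp
      · rw [titsGen_eq_zero (by omega) (by omega) (by omega), h2, h5]
        simp
      · obtain rfl := eq_of_slot_half hs (h2.trans h5.symm)
        rw [titsGen_self (by omega), twist_mul_self]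
        simp
  · have hs' : (slot n a : ℕ) ≠ slot n b := fun h => hs (Fin.ext h)
    rw [if_neg hs]
    rcases pos_cases a with ⟨h1, h2, h3⟩ | ⟨h1, h2, h3⟩ <;>
    rcases pos_cases b with ⟨h4, h5, h6⟩ | ⟨h4, h5, h6⟩ <;>
      exact (titsGen_eq_zero (by omega) (by omega) (by omega)).symm

/-- A short generator makes a quarter turn in each half, a transposition with one sign. Slots
decrease with position in the upper half and increase in the lower, so the sign falls on opposite
ends; `twist_mul_twist` corrects this. -/
theorem planeHom_shortLift (i' i : Fin n) (hi : (i : ℕ) = i' + 1) :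
    (planeHom n (shortLift n i' i) : Matrix (Fin (2 * n)) (Fin (2 * n)) ℂ) = titsGen n i := by
  ext a b
  have hI : ∀ j, quarterIm ((shortLift n i' i).left j) = 0 := by
    intro j
    rw [shortLift_left]
    split_ifs <;> simp [quarterIm_mul]
  have hR : ∀ j, quarterRe ((shortLift n i' i).left j) = if j = i then -1 else 1 := by
    intro j
    rw [shortLift_left]
    split_ifs <;> simp [quarterRe_mul]
  have hr : (shortLift n i' i).right = Equiv.swap i' i := rfl
  rw [planeHom_apply, quarterMatrix_apply, hI, hR, hr]
  have hi2 := i.2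
  by_cases h : slot n a = Equiv.swap i' i (slot n b)
  · rw [if_pos h]
    by_cases hb1 : slot n b = i'
    · have hb1' := congrArg Fin.val hb1
      rw [hb1, Equiv.swap_apply_left] at h
      have ha' := congrArg Fin.val h
      rw [if_pos h]
      rcases pos_cases a with ⟨h1, h2, h3⟩ | ⟨h1, h2, h3⟩ <;>
      rcases pos_cases b with ⟨h4, h5, h6⟩ | ⟨h4, h5, h6⟩
      · rw [twist_of_half_eq_zero h2, twist_of_half_eq_zero h5, h2, h5,
          titsGen_eq_neg_one (by omega)]
        simp
      · rw [titsGen_eq_zero (by omega) (by omega) (by omega), h2, h5]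
        simp
      · rw [titsGen_eq_zero (by omega) (by omega) (by omega), h2, h5]
        simp
      · rw [mul_comm (twist n a : ℂ), twist_mul_twist h5 h2 (by omega), h2, h5,
          titsGen_eq_one (by omega)]
        simp
    · have hb1' : (slot n b : ℕ) ≠ i' := fun h => hb1 (Fin.ext h)
      by_cases hb2 : slot n b = i
      · have hb2' := congrArg Fin.val hb2
        rw [hb2, Equiv.swap_apply_right] at h
        have ha' := congrArg Fin.val h
        have hai : slot n a ≠ i := fun h' => by
          have := congrArg Fin.val h'
          omega
        rw [if_neg hai]
        rcases pos_cases a with ⟨h1, h2, h3⟩ | ⟨h1, h2, h3⟩ <;>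
        rcases pos_cases b with ⟨h4, h5, h6⟩ | ⟨h4, h5, h6⟩
        · rw [twist_of_half_eq_zero h2, twist_of_half_eq_zero h5, h2, h5,
            titsGen_eq_one (by omega)]
          simp
        · rw [titsGen_eq_zero (by omega) (by omega) (by omega), h2, h5]
          simp
        · rw [titsGen_eq_zero (by omega) (by omega) (by omega), h2, h5]
          simp
        · rw [twist_mul_twist h2 h5 (by omega), h2, h5, titsGen_eq_neg_one (by omega)]
          simp
      · have hb2' : (slot n b : ℕ) ≠ i := fun h => hb2 (Fin.ext h)
        rw [Equiv.swap_apply_of_ne_of_ne hb1 hb2] at h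
        have hs' := congrArg Fin.val h
        have hai : slot n a ≠ i := fun h' => hb2 (h.symm.trans h')
        rw [if_neg hai]
        rcases pos_cases a with ⟨h1, h2, h3⟩ | ⟨h1, h2, h3⟩ <;>
        rcases pos_cases b with ⟨h4, h5, h6⟩ | ⟨h4, h5, h6⟩
        · obtain rfl := eq_of_slot_half h (h2.trans h5.symm)
          rw [titsGen_self (by omega), twist_mul_self]
          simp
        · rw [titsGen_eq_zero (by omega) (by omega) (by omega), h2, h5]
          simp
        · rw [titsGen_eq_zero (by omega) (by omega) (by omega), h2, h5]
          simp
        · obtain rfl := eq_of_slot_half h (h2.trans h5.symm)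
          rw [titsGen_self (by omega), twist_mul_self]
          simp
  · rw [if_neg h]
    -- The transposition is spelled out as numerical conditions for `omega`.
    have h' : ((slot n b : ℕ) = i' → (slot n a : ℕ) ≠ i) ∧
        ((slot n b : ℕ) = i → (slot n a : ℕ) ≠ i') ∧
        ((slot n b : ℕ) ≠ i' → (slot n b : ℕ) ≠ i → (slot n a : ℕ) ≠ slot n b) := by
      refine ⟨fun h1 h2 => h ?_, fun h1 h2 => h ?_, fun h1 h2 h3 => h ?_⟩
      · rw [Fin.ext h1, Equiv.swap_apply_left, Fin.ext h2]
      · rw [Fin.ext h1, Equiv.swap_apply_right, Fin.ext h2]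
      · rw [Equiv.swap_apply_of_ne_of_ne (fun h => h1 (congrArg Fin.val h))
          (fun h => h2 (congrArg Fin.val h)), Fin.ext h3]
    rcases pos_cases a with ⟨h1, h2, h3⟩ | ⟨h1, h2, h3⟩ <;>
    rcases pos_cases b with ⟨h4, h5, h6⟩ | ⟨h4, h5, h6⟩ <;>
      exact (titsGen_eq_zero (by omega) (by omega) (by omega)).symm

end

noncomputable section

/-! ### The Tits group -/

theorem quarter_mul_comm (c d : quarterGroup) : c * d = d * c := by
  rw [quarterGroup.ext_iff', quarterRe_mul, quarterRe_mul, quarterIm_mul, quarterIm_mul]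
  constructor <;> ring

theorem mem_zpowers_quarterJ (c : quarterGroup) : c ∈ Subgroup.zpowers quarterJ := by
  have hJ := Subgroup.mem_zpowers quarterJ
  rcases quarter_cases c with ⟨h1, h2 | h2⟩ | ⟨h1, h2 | h2⟩
  · have : c = 1 := quarterGroup.ext_iff'.2 (by simp [h1, h2])
    exact this ▸ one_mem _
  · have : c = quarterJ * quarterJ :=
      quarterGroup.ext_iff'.2 (by simp [h1, h2, quarterRe_mul, quarterIm_mul])
    exact this ▸ mul_mem hJ hJ
  · have : c = quarterJ := quarterGroup.ext_iff'.2 (by simp [h1, h2])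
    exact this ▸ hJ
  · have : c = quarterJ⁻¹ := quarterGroup.ext_iff'.2 (by simp [h1, h2])
    exact this ▸ inv_mem hJ

/-- The transposition carries `j` from slot `i'` to slot `i`; the extra sign is harmless because the
factors commute. -/
theorem shortLift_mul_longLift {n : ℕ} (i' i : Fin n) :
    shortLift n i' i * longLift n i' = longLift n i * shortLift n i' i := by
  refine Wr.ext_iff'.2 ⟨fun j => ?_, rfl⟩
  have h : (Pi.mulSingle i' quarterJ : Fin n → quarterGroup) ((Equiv.swap i' i)⁻¹ j) =
      (Pi.mulSingle i quarterJ : Fin n → quarterGroup) j := by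
    rw [Equiv.swap_inv]
    by_cases hj : j = i
    · subst hj; simp
    · have : Equiv.swap i' i j ≠ i' := fun h => hj (by
        rw [Equiv.swap_apply_eq_iff, Equiv.swap_apply_left] at h
        exact h)
      simp [hj, this]
  change (Pi.mulSingle i (quarterJ * quarterJ) : Fin n → quarterGroup) j * 1 *
    (Pi.mulSingle i' quarterJ : Fin n → quarterGroup) ((Equiv.swap i' i)⁻¹ j) =
    (Pi.mulSingle i quarterJ : Fin n → quarterGroup) j *
    ((Pi.mulSingle i (quarterJ * quarterJ) : Fin n → quarterGroup) j * 1)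
  rw [h, mul_one, quarter_mul_comm]

/-- Conjugation by short lifts spreads `j` from slot `0` to all slots, which gives the whole base
group. Modulo it the short lifts are the adjacent transpositions, which generate the symmetric
group. -/
theorem eq_top_of_lifts_mem {ℓ : ℕ} (K : Subgroup (Wr (ℓ + 1) quarterGroup))
    (h0 : longLift (ℓ + 1) 0 ∈ K)
    (hs : ∀ i : Fin ℓ, shortLift (ℓ + 1) i.castSucc i.succ ∈ K) : K = ⊤ := by
  have hlong : ∀ i, longLift (ℓ + 1) i ∈ K := by
    intro i
    induction i using Fin.induction with
    | zero => exact h0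
    | succ i ih =>
      rw [← mul_inv_eq_iff_eq_mul.2 (shortLift_mul_longLift i.castSucc i.succ)]
      exact mul_mem (mul_mem (hs i) ih) (inv_mem (hs i))
  have hinl : ∀ f, f ∈ K.comap SemidirectProduct.inl := by
    intro f
    refine Subgroup.pi_mem_of_mulSingle_mem f fun i => ?_
    have h1 : Subgroup.zpowers quarterJ ≤ (K.comap SemidirectProduct.inl).comap
        (MonoidHom.mulSingle (fun _ => quarterGroup) i) := by
      rw [Subgroup.zpowers_le]
      exact hlong i
    exact h1 (mem_zpowers_quarterJ (f i))
  have hinr : ∀ σ, σ ∈ K.comap SemidirectProduct.inr := by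
    intro σ
    have h1 : Submonoid.closure (Set.range fun i : Fin ℓ => Equiv.swap i.castSucc i.succ) ≤
        (K.comap (SemidirectProduct.inr : _ →* Wr (ℓ + 1) quarterGroup)).toSubmonoid := by
      rw [Submonoid.closure_le]
      rintro _ ⟨i, rfl⟩
      exact (Subgroup.mul_mem_cancel_left K (hinl _)).1 (hs i)
    rw [Equiv.Perm.mclosure_swap_castSucc_succ] at h1
    exact h1 (Submonoid.mem_top σ)
  rw [eq_top_iff]
  intro x _
  rw [← SemidirectProduct.inl_left_mul_inr_right x]
  exact mul_mem (hinl _) (hinr _)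

variable {ℓ : ℕ}

theorem exists_planeHom_eq_titsGen (i : Fin (ℓ + 1)) : ∃ x,
    (planeHom (ℓ + 1) x : Matrix (Fin (2 * (ℓ + 1))) (Fin (2 * (ℓ + 1))) ℂ) =
      titsGen (ℓ + 1) i := by
  refine Fin.cases ?_ (fun i => ?_) i
  · exact ⟨_, planeHom_longLift 0 rfl⟩
  · exact ⟨_, planeHom_shortLift i.castSucc i.succ (by simp)⟩

theorem range_planeLift : (planeLift (ℓ + 1)).range = titsGroup (ℓ + 1) := by
  apply le_antisymm
  · rw [MonoidHom.range_eq_map, Subgroup.map_le_iff_le_comap]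
    refine (eq_top_of_lifts_mem _ ?_ fun i => ?_).ge
    · exact Subgroup.subset_closure ⟨0, planeHom_longLift 0 rfl⟩
    · exact Subgroup.subset_closure
        ⟨i.succ, planeHom_shortLift i.castSucc i.succ (by simp)⟩
  · refine (Subgroup.closure_le _).2 ?_
    rintro g ⟨i, hi⟩
    obtain ⟨x, hx⟩ := exists_planeHom_eq_titsGen i
    exact ⟨x, Subtype.ext (Subtype.ext (Units.ext (hx.trans hi.symm)))⟩

theorem exists_mem_titsGroup (i : Fin (ℓ + 1)) : ∃ g ∈ titsGroup (ℓ + 1),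
    (((g : Sp (ℓ + 1)) : GL (Fin (2 * (ℓ + 1))) ℂ) :
      Matrix (Fin (2 * (ℓ + 1))) (Fin (2 * (ℓ + 1))) ℂ) = titsGen (ℓ + 1) i := by
  obtain ⟨x, hx⟩ := exists_planeHom_eq_titsGen i
  exact ⟨planeLift _ x, range_planeLift ▸ ⟨x, rfl⟩, hx⟩

/-- The Tits group is `𝔖_n ⋉ {±1, ±j}^n`. -/
def titsEquiv (ℓ : ℕ) : Wr (ℓ + 1) quarterGroup ≃* titsGroup (ℓ + 1) :=
  (MonoidHom.ofInjective planeLift_injective).trans (MulEquiv.subgroupCongr range_planeLift)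

theorem signQuarter_injective : Function.Injective signQuarter := fun _ _ h =>
  signHom_injective (congrArg Subtype.val h)

/-- The Tits extension of the symplectic Weyl group. -/
def titsExtension (ℓ : ℕ) :
    GroupExtension (Fin (ℓ + 1) → Mu2) (titsGroup (ℓ + 1)) (SpWeyl (ℓ + 1)) where
  inl := (titsEquiv ℓ).toMonoidHom.comp
    (SemidirectProduct.inl.comp (piMap (ℓ + 1) signQuarter))
  rightHom := (QuotientGroup.mk' _).comp (titsGroup (ℓ + 1)).subtype
  inl_injective :=
    (titsEquiv ℓ).injective.comp (Wr.inl_comp_piMap_injective signQuarter_injective)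
  range_inl_eq_ker_rightHom := by
    ext g
    obtain ⟨x, rfl⟩ := (titsEquiv ℓ).surjective g
    have h1 : titsEquiv ℓ x ∈
        ((QuotientGroup.mk' ((spTorus (ℓ + 1)).subgroupOf (spNormalizer (ℓ + 1)))).comp
          (titsGroup (ℓ + 1)).subtype).ker ↔ x ∈ (planeToWeyl (ℓ + 1)).ker := Iff.rfl
    rw [h1, ker_planeToWeyl, ← Wr.range_inl_comp_piMap range_signQuarter]
    exact exists_congr fun e => (titsEquiv ℓ).injective.eq_iff
  rightHom_surjective := fun w => by
    obtain ⟨x, rfl⟩ := planeToWeyl_surjective w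
    exact ⟨titsEquiv ℓ x, rfl⟩

theorem titsExtension_rightHom_titsEquiv (x : Wr (ℓ + 1) quarterGroup) :
    (titsExtension ℓ).rightHom (titsEquiv ℓ x) = planeToWeyl (ℓ + 1) x := rfl

theorem titsExtension_inl_coe (e : Fin (ℓ + 1) → Mu2) :
    ((((titsExtension ℓ).inl e : spNormalizer (ℓ + 1)) : Sp (ℓ + 1)) :
      GL (Fin (2 * (ℓ + 1))) ℂ) =
    torusElt (ℓ + 1) fun i => Units.map (algebraMap ℝ ℂ : ℝ →* ℂ) ((e i : Mu2) : ℝˣ) :=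
  planeHom_inl_sign e

theorem exists_titsExtension_inl_eq {h : Sp (ℓ + 1)} (hh : h ∈ spTorus (ℓ + 1))
    (h2 : h ^ 2 = 1) :
    ∃ e, (((titsExtension ℓ).inl e : spNormalizer (ℓ + 1)) : Sp (ℓ + 1)) = h := by
  obtain ⟨z, hz⟩ := mem_spTorus_iff.1 hh
  have h3 : torusElt (ℓ + 1) z ^ 2 = 1 := by
    rw [hz, ← Subgroup.coe_pow, h2]
    rfl
  rw [torusElt_eq, ← map_pow, ← map_one (diagHom (2 * (ℓ + 1)) ℂ)] at h3
  have h4 : ∀ i, z i ^ 2 = 1 := fun i => by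
    have := congrFun (diagHom_injective h3) ((posEquiv (ℓ + 1)).symm (i, 0))
    rwa [Pi.pow_apply, torusCoord_symm_zero] at this
  have h5 : ∀ i, ∃ e : Mu2, Units.map (algebraMap ℝ ℂ : ℝ →* ℂ) (e : ℝˣ) = z i := by
    intro i
    have h6 : (z i : ℂ) ^ 2 = 1 := congrArg Units.val (h4 i)
    rcases sq_eq_one_iff.1 h6 with h | h
    · exact ⟨1, Units.ext (by simp [h])⟩
    · exact ⟨⟨-1, by simp⟩, Units.ext (by simp [h])⟩
  choose e he using h5
  refine ⟨e, Subtype.ext ?_⟩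
  rw [titsExtension_inl_coe, ← hz]
  exact congrArg _ (funext he)

/-! ### The embedding of the symplectic Weyl group -/

/-- The embedding of the symplectic Weyl group into the quaternionic one. -/
def spWeylEmb (n : ℕ) : SpWeyl n →* WeylGroup n ℍ[ℝ] :=
  ((weylEquiv n).toMonoidHom.comp (Wr.map n galToSO3)).comp (spWeylEquiv n).toMonoidHom

variable {n : ℕ}

theorem spWeylEmb_injective : Function.Injective (spWeylEmb n) :=
  (weylEquiv n).injective.comp
    ((Wr.map_injective galToSO3_injective).comp (spWeylEquiv n).injective)

/-- Componentwise this is `galToSO3_quarterToGal`; it shows that the two projections of `𝔖_n ⋉ {±1,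
±j}^n` agree under the embedding. -/
theorem spWeylEmb_planeToWeyl (x : Wr n quarterGroup) :
    spWeylEmb n (planeToWeyl n x) =
      (weylExtension n).rightHom (Wr.map n quarterGroup.subtype x) := by
  change weylEquiv n (Wr.map n galToSO3 (spWeylEquiv n (planeToWeyl n x))) = weylEquiv n _
  rw [spWeylEquiv_planeToWeyl]
  congr 1
  exact Wr.ext_iff'.2 ⟨fun i => galToSO3_quarterToGal _, rfl⟩

/-- The group `𝔖_n ⋉ {±1, ±j}^n` inside the preimage of the symplectic Weyl group. -/
def quarterToPreimage (n : ℕ) :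
    Wr n quarterGroup →* (spWeylEmb n).range.comap (weylExtension n).rightHom :=
  (Wr.map n quarterGroup.subtype).codRestrict _ fun x =>
    ⟨planeToWeyl n x, spWeylEmb_planeToWeyl x⟩

/-- For surjectivity, lying over the embedded Weyl group means that each component has its rotation
in the range of `galToSO3`, so `mem_quarterGroup_iff` applies slot by slot. -/
theorem quarterToPreimage_bijective : Function.Bijective (quarterToPreimage n) := by
  constructor
  · intro x y h
    exact Wr.map_injective quarterGroup.subtype_injective (congrArg Subtype.val h)
  · rintro ⟨y, w, hw⟩
    have h1 : Wr.map n galToSO3 (spWeylEquiv n w) = Wr.map n spin y := (weylEquiv n).injective hw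
    have h2 : ∀ i, y.left i ∈ quarterGroup := fun i =>
      (mem_quarterGroup_iff _).2 ⟨_, (Wr.ext_iff'.1 h1).1 i⟩
    exact ⟨⟨fun i => ⟨y.left i, h2 i⟩, y.right⟩, rfl⟩

/-- The Tits group is the preimage of the symplectic Weyl group in the extended quaternionic Weyl
group. -/
def titsEquivPreimage (ℓ : ℕ) : titsGroup (ℓ + 1) ≃*
    (spWeylEmb (ℓ + 1)).range.comap (weylExtension (ℓ + 1)).rightHom :=
  (titsEquiv ℓ).symm.trans (MulEquiv.ofBijective _ quarterToPreimage_bijective)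

theorem titsEquivPreimage_titsEquiv (x : Wr (ℓ + 1) quarterGroup) :
    (titsEquivPreimage ℓ (titsEquiv ℓ x) : ExtWeyl (ℓ + 1)) =
      Wr.map (ℓ + 1) quarterGroup.subtype x := by
  rw [titsEquivPreimage, MulEquiv.trans_apply, MulEquiv.symm_apply_apply]
  rfl

theorem titsEquivPreimage_inl (e : Fin (ℓ + 1) → Mu2) :
    (titsEquivPreimage ℓ ((titsExtension ℓ).inl e) : ExtWeyl (ℓ + 1)) =
      (weylExtension (ℓ + 1)).inl e :=
  titsEquivPreimage_titsEquiv _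

theorem rightHom_titsEquivPreimage (g : titsGroup (ℓ + 1)) :
    (weylExtension (ℓ + 1)).rightHom (titsEquivPreimage ℓ g : ExtWeyl (ℓ + 1)) =
      spWeylEmb (ℓ + 1) ((titsExtension ℓ).rightHom g) := by
  obtain ⟨x, rfl⟩ := (titsEquiv ℓ).surjective g
  rw [titsEquivPreimage_titsEquiv, titsExtension_rightHom_titsEquiv, spWeylEmb_planeToWeyl]

end

end QuatWeyl

theorem mainTheorem10 (ℓ : ℕ) :
    -- the exact sequence `1 → μ_2 → SU_2 → SO_3 → 1`, with `SU_2` the unit quaternions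
    (∃ χ : QuatWeyl.UnitQuat ≃* QuatWeyl.SU2,
      ∀ q, (χ q : Matrix (Fin 2) (Fin 2) ℂ) = QuatWeyl.quatMatrix q) ∧
    (∃ S : GroupExtension QuatWeyl.Mu2 QuatWeyl.UnitQuat QuatWeyl.SO3,
      S.inl = QuatWeyl.signHom ∧ S.rightHom = QuatWeyl.spin) ∧
    -- the quaternionic Weyl group is `𝔖 ⋉ SO_3^{ℓ+1}`
    ∃ Θ : QuatWeyl.Wr (ℓ + 1) QuatWeyl.SO3 ≃* QuatWeyl.WeylGroup (ℓ + 1) ℍ[ℝ],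
      (∀ (x : QuatWeyl.Wr (ℓ + 1) QuatWeyl.SO3) (d : Fin (ℓ + 1) → (ℍ[ℝ])ˣ),
        ((((Θ x : MulAut (QuatWeyl.diagSubgroup (ℓ + 1) ℍ[ℝ])) (QuatWeyl.toDiag (ℓ + 1) ℍ[ℝ] d) :
            QuatWeyl.diagSubgroup (ℓ + 1) ℍ[ℝ]) : GL (Fin (ℓ + 1)) ℍ[ℝ]) :
            Matrix (Fin (ℓ + 1)) (Fin (ℓ + 1)) ℍ[ℝ]) =
          Matrix.diagonal fun i => QuatWeyl.rotAct (x.left i) (d (x.right⁻¹ i))) ∧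
    -- the extension of the quaternionic Weyl group by `(μ_2)^{ℓ+1}`
    ∃ E : GroupExtension (Fin (ℓ + 1) → QuatWeyl.Mu2) (QuatWeyl.ExtWeyl (ℓ + 1))
        (QuatWeyl.WeylGroup (ℓ + 1) ℍ[ℝ]),
      E.inl = QuatWeyl.extInl (ℓ + 1) ∧
      E.rightHom = Θ.toMonoidHom.comp (QuatWeyl.Wr.map (ℓ + 1) QuatWeyl.spin) ∧
    -- the extended group embeds into `GL_{ℓ+1}(ℍ)`, compatibly with the conjugation action
      Function.Injective (QuatWeyl.extEmbedding (ℓ + 1)) ∧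
      (∀ x : QuatWeyl.ExtWeyl (ℓ + 1),
        ∃ hx : QuatWeyl.extEmbedding (ℓ + 1) x ∈
            Subgroup.normalizer (QuatWeyl.diagSubgroup (ℓ + 1) ℍ[ℝ] : Set (GL (Fin (ℓ + 1)) ℍ[ℝ])),
          QuatWeyl.toWeyl (ℓ + 1) ℍ[ℝ] ⟨QuatWeyl.extEmbedding (ℓ + 1) x, hx⟩ = E.rightHom x) ∧
    -- the Weyl group of `Sp_{2ℓ+2}` is `𝔖 ⋉ Gal(ℂ/ℝ)^{ℓ+1}`, acting by signed permutations
    ∃ Ψ : QuatWeyl.SpWeyl (ℓ + 1) ≃* QuatWeyl.Wr (ℓ + 1) QuatWeyl.GalCR,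
      (∀ (g : QuatWeyl.spNormalizer (ℓ + 1)) (z : Fin (ℓ + 1) → ℂˣ),
        ((g : QuatWeyl.Sp (ℓ + 1)) : GL (Fin (2 * (ℓ + 1))) ℂ) * QuatWeyl.torusElt (ℓ + 1) z *
            ((g : QuatWeyl.Sp (ℓ + 1)) : GL (Fin (2 * (ℓ + 1))) ℂ)⁻¹ =
          QuatWeyl.torusElt (ℓ + 1) fun i =>
            QuatWeyl.signAct ((Ψ (QuotientGroup.mk g)).left i)
              (z ((Ψ (QuotientGroup.mk g)).right⁻¹ i))) ∧
    -- the splitting `Gal(ℂ/ℝ) → Aut_ℂ(ℍ) ⊂ SO_3`, conjugation going to `Ad_j`,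
    -- and the resulting embedding of the symplectic Weyl group
    ∃ γ : QuatWeyl.GalCR →* QuatWeyl.SO3,
      γ Complex.conjAe = QuatWeyl.spin QuatWeyl.quatJ ∧
      (∀ (s : QuatWeyl.GalCR) (z : ℂ), QuatWeyl.rotAct (γ s) (z : ℍ[ℝ]) = ((s z : ℂ) : ℍ[ℝ])) ∧
    ∃ emb : QuatWeyl.SpWeyl (ℓ + 1) →* QuatWeyl.WeylGroup (ℓ + 1) ℍ[ℝ],
      emb = (Θ.toMonoidHom.comp (QuatWeyl.Wr.map (ℓ + 1) γ)).comp Ψ.toMonoidHom ∧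
      Function.Injective emb ∧
    -- the Tits extension of the symplectic Weyl group by the `2`-torsion of the torus
      (∀ i : Fin (ℓ + 1), ∃ g ∈ QuatWeyl.titsGroup (ℓ + 1),
        (((g : QuatWeyl.Sp (ℓ + 1)) : GL (Fin (2 * (ℓ + 1))) ℂ) :
          Matrix (Fin (2 * (ℓ + 1))) (Fin (2 * (ℓ + 1))) ℂ) = QuatWeyl.titsGen (ℓ + 1) i) ∧
    ∃ T : GroupExtension (Fin (ℓ + 1) → QuatWeyl.Mu2) (QuatWeyl.titsGroup (ℓ + 1))
        (QuatWeyl.SpWeyl (ℓ + 1)),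
      (∀ e : Fin (ℓ + 1) → QuatWeyl.Mu2,
        (((T.inl e : QuatWeyl.spNormalizer (ℓ + 1)) : QuatWeyl.Sp (ℓ + 1)) :
            GL (Fin (2 * (ℓ + 1))) ℂ) =
          QuatWeyl.torusElt (ℓ + 1) fun i =>
            Units.map (algebraMap ℝ ℂ : ℝ →* ℂ) ((e i : QuatWeyl.Mu2) : ℝˣ)) ∧
      (∀ h ∈ QuatWeyl.spTorus (ℓ + 1), h ^ 2 = 1 →
        ∃ e, ((T.inl e : QuatWeyl.spNormalizer (ℓ + 1)) : QuatWeyl.Sp (ℓ + 1)) = h) ∧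
      (∀ g : QuatWeyl.titsGroup (ℓ + 1),
        T.rightHom g = QuotientGroup.mk (g : QuatWeyl.spNormalizer (ℓ + 1))) ∧
    -- it is the restriction of the extension of the quaternionic Weyl group along the embedding
      ∃ Φ : QuatWeyl.titsGroup (ℓ + 1) ≃* emb.range.comap E.rightHom,
        (∀ e, ((Φ (T.inl e) : emb.range.comap E.rightHom) : QuatWeyl.ExtWeyl (ℓ + 1)) = E.inl e) ∧
        (∀ g, E.rightHom ((Φ g : emb.range.comap E.rightHom) : QuatWeyl.ExtWeyl (ℓ + 1)) =
          emb (T.rightHom g)) := by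
  refine ⟨⟨QuatWeyl.unitQuatEquivSU2, fun _ => rfl⟩, ⟨QuatWeyl.spinExtension, rfl, rfl⟩,
    QuatWeyl.weylEquiv _, QuatWeyl.weylEquiv_apply, QuatWeyl.weylExtension _, rfl, rfl,
    QuatWeyl.extEmbedding_injective,
    fun x => ⟨QuatWeyl.extEmbedding_mem_normalizer x, QuatWeyl.toWeyl_extEmbedding x⟩,
    QuatWeyl.spWeylEquiv _, QuatWeyl.conj_torusElt_eq_signAct,
    QuatWeyl.galToSO3, QuatWeyl.galToSO3_conjAe, QuatWeyl.rotAct_galToSO3,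
    QuatWeyl.spWeylEmb _, rfl, QuatWeyl.spWeylEmb_injective, QuatWeyl.exists_mem_titsGroup,
    QuatWeyl.titsExtension ℓ, QuatWeyl.titsExtension_inl_coe,
    fun h hh h2 => QuatWeyl.exists_titsExtension_inl_eq hh h2, fun _ => rfl,
    QuatWeyl.titsEquivPreimage ℓ, QuatWeyl.titsEquivPreimage_inl,
    QuatWeyl.rightHom_titsEquivPreimage⟩
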